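/- **Setting.** Let $\mathcal X\subseteq\mathbb R^d$ be nonempty, convex and compact, let $\ell(x;z)$ be a loss ($x\in\mathcal X$, $z\in\mathbb R^m$), and for each $x\in\mathcal X$ let $\mathcal D(x)$ be a probability distribution on $\mathbb R^m$; put $\mathcal Z=\bigcup_{x\in\mathcal X}\operatorname{supp}\mathcal D(x)$. Assume that $\ell(\cdot;z)$ is differentiable at the points of $\mathcal X$ for $z\in\mathcal Z$, and that $\ell(y;z)$ and $\nabla_x\ell(y;z)$ are integrable over $z\sim\mathcal D(x)$ for all $x,y\in\mathcal X$. *Euclidean assumptions* with parameters $\alpha>0$, $\beta,L\ge0$: for all $x,x'\in\mathcal X$ and $z,z'\in\mathcal Z$, * $\ell(x;z)\ge \ell(x';z)+\langle\nabla_x\ell(x';z),x-x'\rangle+\frac{\alpha}{2}\|x-x'\|_2^2$; * $\|\nabla_x\ell(x;z)-\nabla_x\ell(x';z)\|_2\le\beta\|x-x'\|_2$ and $\|\nabla_x\ell(x;z)-\nabla_x\ell(x;z')\|_2\le\beta\|z-z'\|_2$; * $W_1(\mathcal D(x),\mathcal D(x'))\le L\|x-x'\|_2$, where $W_1$ is the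 Wasserstein-1 distance. Put $\rho=L\beta/\alpha$, and let $G(x)=\operatorname{argmin}_{y\in\mathcal X}\mathbb E_{z\sim\mathcal D(x)}[\ell(y;z)]$ be the repeated-risk-minimization (RRM) map on $\mathcal X$. A point $x^*\in\mathcal X$ is *$\delta$-performatively stable* if $\langle x-x^*,\mathbb E_{z\sim\mathcal D(x^*)}[\nabla_x\ell(x^*;z)]\rangle\ge-\delta$ for all $x\in\mathcal X$. **Algorithms.** An algorithm is a single finite program, the same for all dimensions and instances, for a random access machine that computes exactly with real numbers ($+,-,\times,\div,\sqrt{\cdot}$ and comparisons, at unit cost). Its input is $d$, $\varepsilon$ and a radius $R>0$ with $\mathcal X\subseteq\mathcal B_R(0)$. At cost $d+1$ per call it may query an RRM oracle ($x\in\mathcal X\mapsto G(x)$) and an oracle for the domain $\mathcal X$. **Theorem.** There are an algorithm, an absolute constant $c$ and a polynomial $p$ such that for every instance as above and every $0<\varepsilon<1$ with $\rho\le1+\varepsilon$ the algorithm halts with a point $x^*\in\mathcal X$ satisfying 1. $\langle x-G(x),\,x-x^*\rangle\ge-cR^2\varepsilon$ for all $x\in\mathcal X$ (an $O_\varepsilon(\varepsilon)$-approximate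 Minty solution for the operator $x-G(x)$); 2. $\langle x^*-G(x^*),\,x-x^*\rangle\ge-cR^2\sqrt\varepsilon$ for all $x\in\mathcal X$ (an $O_\varepsilon(\sqrt\varepsilon)$-approximate Stampacchia solution); 3. $\|x^*-G(x^*)\|_2\le cR\,\varepsilon^{1/4}$ (RRM fixed-point gap); 4. $x^*$ is $cR\,\big(\beta(1+L)R+\gamma\big)\,\varepsilon^{1/4}$-performatively stable, where $\gamma=\|\mathbb E_{z\sim\mathcal D(x_0)}[\nabla_x\ell(x_0;z)]\|_2$ and $x_0$ is any point of $\mathcal X$. This holds in each of the following two access models (with possibly different algorithms, constants and polynomials): * (a) $\mathcal X$ is well bounded, $\mathcal B_r(0)\subseteq\mathcal X\subseteq\mathcal B_R(0)$ with $0<r\le R$, and the domain oracle is a separation oracle for $\mathcal X$; the number of steps is at most $p(d,\log(1/\varepsilon),\log(R/r))$, and $r$ need not be known to the algorithm; * (b) $\mathcal X\subseteq\mathcal B_R(0)$ is an arbitrary nonempty convex compact set and the domain oracle is the Euclidean projection onto $\mathcal X$; the number of steps is at most $p(d,\log(1/\varepsilon))$. -/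

import Mathlib

open MeasureTheory

noncomputable section

/-! ## Performative prediction -/

/-- The Euclidean space `ℝ^d`. -/
abbrev Vec (d : ℕ) : Type := EuclideanSpace ℝ (Fin d)

/-- A coupling of `μ` and `ν`: a measure on the product with marginals `μ` and `ν`. -/
def IsCoupling {m : ℕ} (μ ν : Measure (Vec m)) (π : Measure (Vec m × Vec m)) : Prop :=
  π.map Prod.fst = μ ∧ π.map Prod.snd = ν

/-- The Wasserstein-1 (earth mover's) distance: infimal expected transport distance over all
couplings. -/
def wasserstein1 {m : ℕ} (μ ν : Measure (Vec m)) : ENNReal :=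
  ⨅ (π : Measure (Vec m × Vec m)) (_ : IsCoupling μ ν π), ∫⁻ p, edist p.1 p.2 ∂π

/-- A performative prediction problem: a nonempty convex compact parameter set `X ⊆ ℝ^d`, a loss
`loss x z`, and for every `x ∈ X` a probability distribution `law x` on `ℝ^m`. The gradients and
expectations the problem speaks about are required to exist. -/
structure PerfProblem (d m : ℕ) where
  X : Set (Vec d)
  loss : Vec d → Vec m → ℝ
  law : Vec d → Measure (Vec m)
  nonempty_X : X.Nonempty
  convex_X : Convex ℝ X
  compact_X : IsCompact X
  prob_law : ∀ x ∈ X, IsProbabilityMeasure (law x)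
  differentiable_loss : ∀ x ∈ X, ∀ z ∈ ⋃ x' ∈ X, (law x').support,
    DifferentiableAt ℝ (fun y => loss y z) x
  integrable_loss : ∀ x ∈ X, ∀ y ∈ X, Integrable (fun z => loss y z) (law x)
  integrable_grad : ∀ x ∈ X, ∀ y ∈ X,
    Integrable (fun z => gradient (fun y' => loss y' z) y) (law x)

namespace PerfProblem

variable {d m : ℕ} (P : PerfProblem d m)

/-- The data domain `Z`, the union of the supports of the induced distributions. -/
def Z : Set (Vec m) := ⋃ x ∈ P.X, (P.law x).support

/-- `∇ₓ ℓ(x; z)`. -/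
def grad (x : Vec d) (z : Vec m) : Vec d := gradient (fun y => P.loss y z) x

/-- The expected loss of `y` under the distribution induced by `x`. -/
def expLoss (x y : Vec d) : ℝ := ∫ z, P.loss y z ∂(P.law x)

/-- The expected gradient `𝔼_{z ∼ D(x)} ∇ ℓ(y; z)`. -/
def expGrad (x y : Vec d) : Vec d := ∫ z, P.grad y z ∂(P.law x)

/-- The Euclidean assumptions: `α`-strong convexity, joint `β`-smoothness, `L`-sensitivity. -/
structure EuclideanAssumptions (α β L : ℝ) : Prop where
  alpha_pos : 0 < α
  beta_nonneg : 0 ≤ β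
  L_nonneg : 0 ≤ L
  strong_convexity : ∀ x ∈ P.X, ∀ x' ∈ P.X, ∀ z ∈ P.Z,
    P.loss x z ≥ P.loss x' z + inner ℝ (P.grad x' z) (x - x') + α / 2 * ‖x - x'‖ ^ 2
  smooth_param : ∀ x ∈ P.X, ∀ x' ∈ P.X, ∀ z ∈ P.Z, ‖P.grad x z - P.grad x' z‖ ≤ β * ‖x - x'‖
  smooth_data : ∀ x ∈ P.X, ∀ z ∈ P.Z, ∀ z' ∈ P.Z, ‖P.grad x z - P.grad x z'‖ ≤ β * ‖z - z'‖
  sensitivity : ∀ x ∈ P.X, ∀ x' ∈ P.X,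
    wasserstein1 (P.law x) (P.law x') ≤ ENNReal.ofReal (L * ‖x - x'‖)

/-- `G` is the repeated-risk-minimization map on `X`:
`G x ∈ argmin_{y ∈ X} 𝔼_{z ∼ D(x)} ℓ(y; z)` for `x ∈ X`. Nothing is said about `G` off `X`. -/
def IsRRMMap (G : Vec d → Vec d) : Prop :=
  ∀ x ∈ P.X, G x ∈ P.X ∧ ∀ y ∈ P.X, P.expLoss x (G x) ≤ P.expLoss x y

/-- `x` is a (first-order) `δ`-performatively stable point. -/
def IsPerfStable (δ : ℝ) (x : Vec d) : Prop :=
  x ∈ P.X ∧ ∀ y ∈ P.X, inner ℝ (y - x) (P.expGrad x x) ≥ -δ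

/-- The quality of the computed point `x`, for the RRM map `G`, up to the absolute constant `c`,
for a domain of radius at most `R`: `x` is an `O(ε)`-solution of the Minty variational inequality
and an `O(√ε)`-solution of the Stampacchia variational inequality of `id - G`, an
`O(ε^{1/4})`-fixed point of `G`, and an `O(ε^{1/4})`-performatively stable point. The last
constant also involves `β`, `L` and the size of the expected gradient at any one point `x₀`. -/
structure Guarantee (G : Vec d → Vec d) (β L R ε c : ℝ) (x : Vec d) : Prop where
  mem : x ∈ P.X
  minty : ∀ y ∈ P.X, inner ℝ (y - G y) (y - x) ≥ -(c * R ^ 2 * ε)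
  stampacchia : ∀ y ∈ P.X, inner ℝ (x - G x) (y - x) ≥ -(c * R ^ 2 * √ε)
  fixed_point_gap : ‖x - G x‖ ≤ c * R * ε ^ (1 / 4 : ℝ)
  stable : ∀ x₀ ∈ P.X,
    P.IsPerfStable (c * R * (β * (1 + L) * R + ‖P.expGrad x₀ x₀‖) * ε ^ (1 / 4 : ℝ)) x

end PerfProblem

/-- `S` is a separation oracle for `X`: it answers `0` on points of `X`, and the normal of a
strictly separating hyperplane on all other points. -/
def IsSeparationOracle {d : ℕ} (X : Set (Vec d)) (S : Vec d → Vec d) : Prop :=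
  ∀ y, (y ∈ X → S y = 0) ∧ (y ∉ X → S y ≠ 0 ∧ ∀ x ∈ X, inner ℝ (S y) x < inner ℝ (S y) y)

/-- `Q` is the Euclidean projection onto `X`. -/
def IsProjectionOracle {d : ℕ} (X : Set (Vec d)) (Q : Vec d → Vec d) : Prop :=
  ∀ y, Q y ∈ X ∧ ∀ x ∈ X, ‖y - Q y‖ ≤ ‖y - x‖

/-! ## Real random access machines with oracles

A uniform machine model with exact real arithmetic. Programs are finite and do not depend on the
dimension. A store has natural-number index registers and real matrices, both numbered by `ℕ`.
There is no conversion from reals to naturals, and index registers can only be cleared,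
incremented and copied. -/

/-- The memory: `idx i` is the index register number `i`, and `mem a i j` is entry `(i, j)` of
the real matrix number `a`. Vectors are stored in column `0`. -/
@[ext] structure Store where
  idx : ℕ → ℕ
  mem : ℕ → ℕ → ℕ → ℝ

/-- Real expressions. `cell a i j` is the entry of matrix `a` whose row and column are the current
contents of the index registers `i` and `j`; `ofIdx i` is the content of index register `i`. -/
inductive RExpr where
  | const (q : ℚ)
  | ofIdx (i : ℕ)
  | cell (a i j : ℕ)
  | add (e f : RExpr)
  | sub (e f : RExpr)
  | mul (e f : RExpr)
  | div (e f : RExpr)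
  | sqrt (e : RExpr)

namespace RExpr

def eval (s : Store) : RExpr → ℝ
  | const q => (q : ℝ)
  | ofIdx i => (s.idx i : ℝ)
  | cell a i j => s.mem a (s.idx i) (s.idx j)
  | add e f => e.eval s + f.eval s
  | sub e f => e.eval s - f.eval s
  | mul e f => e.eval s * f.eval s
  | div e f => e.eval s / f.eval s
  | sqrt e => √(e.eval s)

/-- Evaluation cost: one step for each operation, constant or memory access. -/
def cost : RExpr → ℕ
  | const _ => 1
  | ofIdx _ => 1
  | cell _ _ _ => 1
  | add e f => e.cost + f.cost + 1
  | sub e f => e.cost + f.cost + 1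
  | mul e f => e.cost + f.cost + 1
  | div e f => e.cost + f.cost + 1
  | sqrt e => e.cost + 1

end RExpr

/-- Tests: comparison of two index registers or of two real expressions. -/
inductive Test where
  | idxLt (i j : ℕ)
  | realLe (e f : RExpr)

namespace Test

def holds (s : Store) : Test → Prop
  | idxLt i j => s.idx i < s.idx j
  | realLe e f => e.eval s ≤ f.eval s

def cost : Test → ℕ
  | idxLt _ _ => 1
  | realLe e f => e.cost + f.cost + 1

end Test

/-- Programs. `askDomain a b` and `askRRM a b` pass the vector in matrix `a` to the respective
oracle and write the answer to matrix `b`. -/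
inductive Program where
  | skip
  | seq (p q : Program)
  | idxZero (i : ℕ)
  | idxIncr (i : ℕ)
  | idxCopy (i j : ℕ)
  | assign (a i j : ℕ) (e : RExpr)
  | askDomain (a b : ℕ)
  | askRRM (a b : ℕ)
  | branch (t : Test) (p q : Program)
  | loop (t : Test) (p : Program)

namespace Store

/-- The vector of `ℝ^d` in the first `d` rows of column `0` of matrix `a`. -/
def vec (s : Store) (d a : ℕ) : Vec d := WithLp.toLp 2 fun i => s.mem a i 0

def setIdx (s : Store) (i v : ℕ) : Store := { s with idx := Function.update s.idx i v }

def setCell (s : Store) (a i j : ℕ) (v : ℝ) : Store :=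
  { s with mem := fun a' i' j' => if a' = a ∧ i' = i ∧ j' = j then v else s.mem a' i' j' }

def setVec {d : ℕ} (s : Store) (a : ℕ) (v : Vec d) : Store :=
  { s with mem := fun a' i' j' =>
      if h : a' = a ∧ i' < d ∧ j' = 0 then v ⟨i', h.2.1⟩ else s.mem a' i' j' }

/-- The initial store on input `(d, ε, R)`: index register `0` holds `d`, entry `(0, 0)` of
matrix `0` holds `ε`, entry `(0, 0)` of matrix `1` holds `R`; everything else is zero. -/
def init (d : ℕ) (ε R : ℝ) : Store where
  idx := fun i => if i = 0 then d else 0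
  mem := fun a i j => if i = 0 ∧ j = 0 then (if a = 0 then ε else if a = 1 then R else 0) else 0

end Store

/-- The two oracles: one for access to the domain `X`, and one that answers risk minimization
queries `x ↦ G x`. -/
structure Oracles (d : ℕ) where
  domain : Vec d → Vec d
  rrm : Vec d → Vec d

/-- `Run O p s s' t`: started in store `s`, program `p` halts in store `s'` after `t` steps. An
oracle call costs `d + 1` steps. -/
inductive Run {d : ℕ} (O : Oracles d) : Program → Store → Store → ℕ → Prop where
  | skip (s : Store) : Run O .skip s s 1
  | seq {p q : Program} {s s' s'' : Store} {t t' : ℕ} :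
      Run O p s s' t → Run O q s' s'' t' → Run O (.seq p q) s s'' (t + t')
  | idxZero (i : ℕ) (s : Store) : Run O (.idxZero i) s (s.setIdx i 0) 1
  | idxIncr (i : ℕ) (s : Store) : Run O (.idxIncr i) s (s.setIdx i (s.idx i + 1)) 1
  | idxCopy (i j : ℕ) (s : Store) : Run O (.idxCopy i j) s (s.setIdx i (s.idx j)) 1
  | assign (a i j : ℕ) (e : RExpr) (s : Store) :
      Run O (.assign a i j e) s (s.setCell a (s.idx i) (s.idx j) (e.eval s)) (e.cost + 1)
  | askDomain (a b : ℕ) (s : Store) :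
      Run O (.askDomain a b) s (s.setVec b (O.domain (s.vec d a))) (d + 1)
  | askRRM (a b : ℕ) (s : Store) :
      Run O (.askRRM a b) s (s.setVec b (O.rrm (s.vec d a))) (d + 1)
  | branch_true {c : Test} {p q : Program} {s s' : Store} {t : ℕ} :
      c.holds s → Run O p s s' t → Run O (.branch c p q) s s' (c.cost + t)
  | branch_false {c : Test} {p q : Program} {s s' : Store} {t : ℕ} :
      ¬ c.holds s → Run O q s s' t → Run O (.branch c p q) s s' (c.cost + t)
  | loop_done {c : Test} {p : Program} {s : Store} :
      ¬ c.holds s → Run O (.loop c p) s s c.cost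
  | loop_step {c : Test} {p : Program} {s s' s'' : Store} {t t' : ℕ} :
      c.holds s → Run O p s s' t → Run O (.loop c p) s' s'' t' →
      Run O (.loop c p) s s'' (c.cost + t + t')

/-- Runs are deterministic: final store and number of steps are determined by the start. -/
theorem Run.deterministic {d : ℕ} {O : Oracles d} {p : Program} {s s₁ s₂ : Store} {t₁ t₂ : ℕ}
    (h₁ : Run O p s s₁ t₁) (h₂ : Run O p s s₂ t₂) : s₁ = s₂ ∧ t₁ = t₂ := by
  induction h₁ generalizing s₂ t₂ with
  | skip | idxZero | idxIncr | idxCopy | assign | askDomain | askRRM => cases h₂; exact ⟨rfl, rfl⟩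
  | seq _ _ ih ih' =>
    cases h₂ with
    | seq a b =>
      obtain ⟨rfl, rfl⟩ := ih a
      obtain ⟨rfl, rfl⟩ := ih' b
      exact ⟨rfl, rfl⟩
  | branch_true hc _ ih =>
    cases h₂ with
    | branch_true _ a => obtain ⟨rfl, rfl⟩ := ih a; exact ⟨rfl, rfl⟩
    | branch_false hn _ => exact absurd hc hn
  | branch_false hc _ ih =>
    cases h₂ with
    | branch_true hn _ => exact absurd hn hc
    | branch_false _ a => obtain ⟨rfl, rfl⟩ := ih a; exact ⟨rfl, rfl⟩
  | loop_done hc =>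
    cases h₂ with
    | loop_done _ => exact ⟨rfl, rfl⟩
    | loop_step hn _ _ => exact absurd hn hc
  | loop_step hc _ _ ih ih' =>
    cases h₂ with
    | loop_done hn => exact absurd hc hn
    | loop_step _ a b =>
      obtain ⟨rfl, rfl⟩ := ih a
      obtain ⟨rfl, rfl⟩ := ih' b
      exact ⟨rfl, rfl⟩

end

noncomputable section

/-! ## The risk minimization map is Lipschitz -/

namespace PerfProblem

variable {d m : ℕ} {P : PerfProblem d m} {α β L : ℝ}

/-! Optimality of `G x`, strong convexity and the Lipschitz dependence of the expected gradient on
the law make `G` Lipschitz on `X` with constant `L * β / α` (`norm_rrm_sub_le`). If this constant is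
at most `1 + ε`, the damped map `T = (1 - ε) G` contracts by the factor `(1 - ε)(1 + ε) = 1 - ε ^
2`, and `‖x - T x‖ ≤ ε R` implies `‖x - G x‖ ≤ 2 ε R`. A point with this small a gap has all four
qualities with errors of order `ε`, which is stronger than `√ε` and `ε ^ (1 / 4)` since `ε < 1`
(`Guarantee.of_norm_sub_le`).

The contraction factor only guarantees that iterating `T` succeeds in a number of steps polynomial
in `1 / ε`, so the ellipsoid method is used instead. If the centre `x` has residual larger than `ε
R`, then `x - T x` points away from the fixed point `z` of `T` so clearly that the cut through `x`
keeps a whole ball around `z`, of radius `ε ^ 3 R / 4` (`closedBall_subset_halfspace`). Each cut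
reduces the volume by a fixed factor (`subset_next`, `det_nextShape`, `rate_le`), and the volume
never falls below that of the ball. Hence a small residual is met after a number of cuts polynomial
in `d` and logarithmic in the ratio of the radii (`steps_le`).

With a separation oracle, `0 ∈ X` makes `X` invariant under `T`, and centres outside `X` are cut off
by the oracle. With a projection `Q`, the contraction is `(1 - ε) G ∘ Q` on the whole space, and the
candidate is `Q x`. Arithmetic is exact, so the program follows the ellipsoid recursion without
rounding; its correctness and cost are derived with the Hoare-style predicate `Does`. -/

theorem ae_mem_Z {x : Vec d} (hx : x ∈ P.X) : ∀ᵐ z ∂(P.law x), z ∈ P.Z := by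
  filter_upwards [Measure.support_mem_ae (μ := P.law x)] with z hz
  exact Set.mem_biUnion hx hz

/-- The pointwise inequality holds almost surely because the support has full measure, and
integrates. This is the only link between `expLoss` and `expGrad` that is needed; differentiation
under the integral is avoided. -/
theorem expLoss_strong_convexity (h : P.EuclideanAssumptions α β L) {x y y' : Vec d}
    (hx : x ∈ P.X) (hy : y ∈ P.X) (hy' : y' ∈ P.X) :
    P.expLoss x y' + inner ℝ (P.expGrad x y') (y - y') + α / 2 * ‖y - y'‖ ^ 2 ≤ P.expLoss x y := by
  have := P.prob_law x hx
  have hg : Integrable (fun z => P.grad y' z) (P.law x) := P.integrable_grad x hx y' hy'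
  have hi : Integrable (fun z => inner ℝ (P.grad y' z) (y - y')) (P.law x) :=
    hg.inner_const (y - y')
  have hin : inner ℝ (P.expGrad x y') (y - y') = ∫ z, inner ℝ (P.grad y' z) (y - y') ∂(P.law x) := by
    rw [expGrad, real_inner_comm, ← integral_inner hg]
    simp only [real_inner_comm]
  have hl := P.integrable_loss x hx y' hy'
  have hsum : P.expLoss x y' + inner ℝ (P.expGrad x y') (y - y') + α / 2 * ‖y - y'‖ ^ 2 =
      ∫ z, (P.loss y' z + inner ℝ (P.grad y' z) (y - y') + α / 2 * ‖y - y'‖ ^ 2) ∂(P.law x) := by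
    have hl' : Integrable (fun z => P.loss y' z + inner ℝ (P.grad y' z) (y - y')) (P.law x) :=
      hl.add hi
    rw [integral_add hl' (integrable_const _), integral_add hl hi, hin]
    simp [expLoss]
  rw [hsum]
  refine integral_mono_ae ((hl.add hi).add (integrable_const _)) (P.integrable_loss x hx y hy) ?_
  filter_upwards [ae_mem_Z hx] with z hz
  exact h.strong_convexity y hy y' hy' z hz

theorem norm_expGrad_sub_le (h : P.EuclideanAssumptions α β L) {x y y' : Vec d}
    (hx : x ∈ P.X) (hy : y ∈ P.X) (hy' : y' ∈ P.X) :
    ‖P.expGrad x y - P.expGrad x y'‖ ≤ β * ‖y - y'‖ := by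
  have := P.prob_law x hx
  have hg : Integrable (P.grad y) (P.law x) := P.integrable_grad x hx y hy
  have hg' : Integrable (P.grad y') (P.law x) := P.integrable_grad x hx y' hy'
  rw [expGrad, expGrad, ← integral_sub hg hg']
  have := norm_integral_le_of_norm_le_const (μ := P.law x)
    (f := fun z => P.grad y z - P.grad y' z) (C := β * ‖y - y'‖) (by
      filter_upwards [ae_mem_Z hx] with z hz using h.smooth_param y hy y' hy' z hz)
  simpa using this

/-- A coupling turns the difference of two expectations into one expectation of `P.grad y p.1 -
P.grad y p.2`, to which smoothness in the data applies. This is the easy half of Kantorovich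
duality. -/
theorem enorm_expGrad_sub_le_lintegral (h : P.EuclideanAssumptions α β L) {x x' y : Vec d}
    (hx : x ∈ P.X) (hx' : x' ∈ P.X) (hy : y ∈ P.X) {π : Measure (Vec m × Vec m)}
    (hπ : IsCoupling (P.law x) (P.law x') π) :
    ‖P.expGrad x y - P.expGrad x' y‖ₑ ≤ ENNReal.ofReal β * ∫⁻ p, edist p.1 p.2 ∂π := by
  obtain ⟨h₁, h₂⟩ := hπ
  have hg₁ : Integrable (P.grad y) (π.map Prod.fst) := h₁ ▸ P.integrable_grad x hx y hy
  have hg₂ : Integrable (P.grad y) (π.map Prod.snd) := h₂ ▸ P.integrable_grad x' hx' y hy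
  have e : P.expGrad x y - P.expGrad x' y = ∫ p, (P.grad y p.1 - P.grad y p.2) ∂π := by
    have i₁ : Integrable (fun p : Vec m × Vec m => P.grad y p.1) π :=
      hg₁.comp_measurable measurable_fst
    have i₂ : Integrable (fun p : Vec m × Vec m => P.grad y p.2) π :=
      hg₂.comp_measurable measurable_snd
    rw [integral_sub i₁ i₂, expGrad, expGrad, ← h₁, ← h₂, integral_map measurable_fst.aemeasurable hg₁.1,
      integral_map measurable_snd.aemeasurable hg₂.1]
  have a₁ : ∀ᵐ p ∂π, p.1 ∈ P.Z := ae_of_ae_map measurable_fst.aemeasurable (h₁ ▸ ae_mem_Z hx)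
  have a₂ : ∀ᵐ p ∂π, p.2 ∈ P.Z := ae_of_ae_map measurable_snd.aemeasurable (h₂ ▸ ae_mem_Z hx')
  rw [e, ← lintegral_const_mul' _ _ ENNReal.ofReal_ne_top]
  refine (enorm_integral_le_lintegral_enorm _).trans (lintegral_mono_ae ?_)
  filter_upwards [a₁, a₂] with p hp₁ hp₂
  rw [edist_dist, ← ENNReal.ofReal_mul h.beta_nonneg, dist_eq_norm, ← ofReal_norm]
  exact ENNReal.ofReal_le_ofReal (h.smooth_data y hy _ hp₁ _ hp₂)

theorem norm_expGrad_law_sub_le (h : P.EuclideanAssumptions α β L) {x x' y : Vec d}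
    (hx : x ∈ P.X) (hx' : x' ∈ P.X) (hy : y ∈ P.X) :
    ‖P.expGrad x y - P.expGrad x' y‖ ≤ L * β * ‖x - x'‖ := by
  have hW : 0 ≤ L * ‖x - x'‖ := mul_nonneg h.L_nonneg (norm_nonneg _)
  refine le_of_forall_pos_le_add fun η hη => ?_
  -- The infimum over couplings need not be attained, so a coupling with excess cost below `κ` is
  -- used. The denominator `β + 1` covers `β = 0`.
  obtain ⟨κ, hκ, hκη⟩ : ∃ κ : ℝ, 0 < κ ∧ β * κ ≤ η :=
    ⟨η / (β + 1), div_pos hη (by linarith [h.beta_nonneg]), by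
      rw [mul_div_assoc', div_le_iff₀ (by linarith [h.beta_nonneg])]
      nlinarith [h.beta_nonneg]⟩
  have hlt : wasserstein1 (P.law x) (P.law x') < ENNReal.ofReal (L * ‖x - x'‖ + κ) :=
    (h.sensitivity x hx x' hx').trans_lt ((ENNReal.ofReal_lt_ofReal_iff (by linarith)).2 (by linarith))
  simp only [wasserstein1, iInf_lt_iff] at hlt
  obtain ⟨π, hπ, hlt⟩ := hlt
  have h₁ := (enorm_expGrad_sub_le_lintegral h hx hx' hy hπ).trans (mul_le_mul_right hlt.le _)
  rw [← ENNReal.ofReal_mul h.beta_nonneg, ← ofReal_norm,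
    ENNReal.ofReal_le_ofReal_iff (mul_nonneg h.beta_nonneg (by linarith))] at h₁
  linarith

/-- First-order optimality of the risk minimizer. -/
theorem inner_expGrad_rrm_nonneg (h : P.EuclideanAssumptions α β L) {G : Vec d → Vec d}
    (hG : P.IsRRMMap G) {x y : Vec d} (hx : x ∈ P.X) (hy : y ∈ P.X) :
    0 ≤ inner ℝ (P.expGrad x (G x)) (y - G x) := by
  obtain ⟨hGx, hmin⟩ := hG x hx
  -- Strong convexity based at `u`, evaluated at the minimizer, gives the sign of the gradient at
  -- `u` without differentiating `expLoss`. Smoothness moves the gradient back to `G x` at a price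
  -- of order `t`, which vanishes in the limit.
  have key : ∀ t : ℝ, 0 < t → t ≤ 1 →
      0 ≤ inner ℝ (P.expGrad x (G x)) (y - G x) + t * (β * ‖y - G x‖ ^ 2) := by
    intro t ht ht1
    set u := G x + t • (y - G x) with hu
    have huX : u ∈ P.X := P.convex_X.add_smul_sub_mem hGx hy ⟨ht.le, ht1⟩
    have h₁ := expLoss_strong_convexity h hx hGx huX
    have h₂ := hmin u huX
    have h₃ : 0 ≤ α / 2 * ‖G x - u‖ ^ 2 := by have := h.alpha_pos; positivity
    have h₄ : G x - u = -(t • (y - G x)) := by rw [hu]; abel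
    have h₅ : 0 ≤ inner ℝ (P.expGrad x u) (y - G x) := by
      have : inner ℝ (P.expGrad x u) (G x - u) ≤ 0 := by linarith
      rw [h₄, inner_neg_right, inner_smul_right] at this
      by_contra hcon
      push Not at hcon
      nlinarith
    have h₆ := norm_expGrad_sub_le h hx huX hGx
    have h₇ : u - G x = t • (y - G x) := by rw [hu]; abel
    rw [h₇, norm_smul, Real.norm_eq_abs, abs_of_pos ht] at h₆
    have h₈ := real_inner_le_norm (P.expGrad x u - P.expGrad x (G x)) (y - G x)
    rw [inner_sub_left] at h₈
    have h₉ := mul_le_mul_of_nonneg_right h₆ (norm_nonneg (y - G x))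
    nlinarith
  have lim : Filter.Tendsto
      (fun t : ℝ => inner ℝ (P.expGrad x (G x)) (y - G x) + t * (β * ‖y - G x‖ ^ 2))
      (nhdsWithin 0 (Set.Ioi 0)) (nhds (inner ℝ (P.expGrad x (G x)) (y - G x))) := by
    have : Continuous
        (fun t : ℝ => inner ℝ (P.expGrad x (G x)) (y - G x) + t * (β * ‖y - G x‖ ^ 2)) := by
      fun_prop
    simpa using (this.tendsto 0).mono_left nhdsWithin_le_nhds
  refine ge_of_tendsto lim ?_
  filter_upwards [Ioc_mem_nhdsGT (zero_lt_one' ℝ)] with t ht using key t ht.1 ht.2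

/-- The two strong convexity inequalities between `G x` and `G x'` add up to strong monotonicity of
`P.expGrad x`. Both optimality conditions then leave only the change of the gradient at `G x'` under
the change of law, so that `α ‖G x - G x'‖ ^ 2 ≤ L β ‖x - x'‖ ‖G x - G x'‖`. -/
theorem norm_rrm_sub_le (h : P.EuclideanAssumptions α β L) {G : Vec d → Vec d}
    (hG : P.IsRRMMap G) {x x' : Vec d} (hx : x ∈ P.X) (hx' : x' ∈ P.X) :
    ‖G x - G x'‖ ≤ L * β / α * ‖x - x'‖ := by
  have hg := (hG x hx).1
  have hg' := (hG x' hx').1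
  have o₁ := inner_expGrad_rrm_nonneg h hG hx hg'
  have o₂ := inner_expGrad_rrm_nonneg h hG hx' hg
  have c₁ := expLoss_strong_convexity h hx hg hg'
  have c₂ := expLoss_strong_convexity h hx hg' hg
  have s := norm_expGrad_law_sub_le h hx hx' hg'
  have i := real_inner_le_norm (P.expGrad x (G x') - P.expGrad x' (G x')) (G x' - G x)
  rw [norm_sub_rev (G x') (G x)] at c₂ i
  have e : G x - G x' = -(G x' - G x) := by abel
  rw [e, inner_neg_right] at c₁ o₂
  rw [← e] at c₁
  rw [inner_sub_left] at i
  have b := mul_le_mul_of_nonneg_right s (norm_nonneg (G x - G x'))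
  have k : α * ‖G x - G x'‖ * ‖G x - G x'‖ ≤ L * β * ‖x - x'‖ * ‖G x - G x'‖ := by nlinarith
  rcases (norm_nonneg (G x - G x')).eq_or_lt with h0 | h0
  · rw [← h0]
    have := h.alpha_pos; have := h.beta_nonneg; have := h.L_nonneg
    positivity
  · have := le_of_mul_le_mul_right k h0
    rw [div_mul_eq_mul_div, le_div_iff₀ h.alpha_pos]
    linarith

/-- An approximate fixed point of the risk minimization map has all the desired qualities. -/
theorem Guarantee.of_norm_sub_le (h : P.EuclideanAssumptions α β L) {G : Vec d → Vec d}
    (hG : P.IsRRMMap G) {R ε : ℝ} (hρ : L * β / α ≤ 1 + ε) (hε : 0 < ε) (hε1 : ε < 1) (hR : 0 < R)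
    (hX : P.X ⊆ Metric.closedBall 0 R) {x : Vec d} (hx : x ∈ P.X)
    (hgap : ‖x - G x‖ ≤ 2 * ε * R) : P.Guarantee G β L R ε 8 x := by
  have diam : ∀ y ∈ P.X, ∀ y' ∈ P.X, ‖y - y'‖ ≤ 2 * R := fun y hy y' hy' => by
    have h₁ := mem_closedBall_zero_iff.1 (hX hy)
    have h₂ := mem_closedBall_zero_iff.1 (hX hy')
    linarith [norm_sub_le y y']
  have hsqrt : ε ≤ √ε := Real.le_sqrt_of_sq_le (by nlinarith)
  have hroot : ε ≤ ε ^ (1 / 4 : ℝ) := by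
    simpa using Real.rpow_le_rpow_of_exponent_ge hε hε1.le (by norm_num : (1 / 4 : ℝ) ≤ 1)
  have stamp : ∀ y ∈ P.X, -(4 * R ^ 2 * ε) ≤ inner ℝ (x - G x) (y - x) := fun y hy => by
    have h₁ := (abs_le.1 (abs_real_inner_le_norm (x - G x) (y - x))).1
    have h₂ := mul_le_mul hgap (diam y hy x hx) (norm_nonneg _) (by positivity)
    linarith
  refine ⟨hx, fun y hy => ?_, fun y hy => ?_, ?_, fun x₀ hx₀ => ⟨hx, fun y hy => ?_⟩⟩
  · have h₁ := stamp y hy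
    have h₂ := real_inner_le_norm (G y - G x) (y - x)
    have h₃ := norm_rrm_sub_le h hG hy hx
    have h₄ := mul_le_mul_of_nonneg_right (h₃.trans
      (mul_le_mul_of_nonneg_right hρ (norm_nonneg _))) (norm_nonneg (y - x))
    -- Since `G` is `(1 + ε)`-Lipschitz, the first two terms are at least `-ε ‖y - x‖ ^ 2 ≥ -4 R ^ 2
    -- ε`. The last term costs another `4 R ^ 2 ε`, whence the constant `8`.
    have h₅ : inner ℝ (y - G y) (y - x) =
        ‖y - x‖ ^ 2 - inner ℝ (G y - G x) (y - x) + inner ℝ (x - G x) (y - x) := by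
      rw [← real_inner_self_eq_norm_sq, ← inner_sub_left, ← inner_add_left]
      congr 1; abel
    have h₆ : ‖y - x‖ ^ 2 ≤ (2 * R) ^ 2 := by gcongr; exact diam y hy x hx
    nlinarith
  · have h₁ := stamp y hy
    have : R ^ 2 * ε ≤ R ^ 2 * √ε := by gcongr
    have : 0 ≤ R ^ 2 * √ε := by positivity
    linarith
  · have : R * ε ≤ R * ε ^ (1 / 4 : ℝ) := by gcongr
    nlinarith
  · have hGx := (hG x hx).1
    set γ := ‖P.expGrad x₀ x₀‖
    have n₁ : ‖P.expGrad x (G x)‖ ≤ γ + β * (1 + L) * (2 * R) := by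
      have a₁ := norm_expGrad_sub_le h hx hGx hx₀
      have a₂ := norm_expGrad_law_sub_le h hx hx₀ hx₀
      have a₃ := norm_sub_norm_le (P.expGrad x (G x)) (P.expGrad x x₀)
      have a₄ := norm_sub_norm_le (P.expGrad x x₀) (P.expGrad x₀ x₀)
      have a₅ := mul_le_mul_of_nonneg_left (diam _ hGx _ hx₀) h.beta_nonneg
      have a₆ := mul_le_mul_of_nonneg_left (diam _ hx _ hx₀) (mul_nonneg h.L_nonneg h.beta_nonneg)
      linarith
    have o := inner_expGrad_rrm_nonneg h hG hx hy
    have i₁ := (abs_le.1 (abs_real_inner_le_norm (P.expGrad x (G x)) (x - G x))).2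
    have i₂ := (abs_le.1 (abs_real_inner_le_norm (P.expGrad x x - P.expGrad x (G x)) (y - x))).1
    -- Optimality at `G x` makes the first term nonnegative. The second is bounded by gradient size
    -- times gap, the third by smoothness times gap times diameter.
    have e : inner ℝ (y - x) (P.expGrad x x) = inner ℝ (P.expGrad x (G x)) (y - G x) -
        inner ℝ (P.expGrad x (G x)) (x - G x) +
        inner ℝ (P.expGrad x x - P.expGrad x (G x)) (y - x) := by
      rw [real_inner_comm, ← inner_sub_right, inner_sub_left]
      simp
    have b₁ := mul_le_mul n₁ hgap (norm_nonneg _) ((norm_nonneg _).trans n₁)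
    have b₂ := mul_le_mul (norm_expGrad_sub_le h hx hx hGx) (diam y hy x hx) (norm_nonneg _)
      (mul_nonneg h.beta_nonneg (norm_nonneg _))
    have b₃ := mul_le_mul_of_nonneg_left hgap h.beta_nonneg
    have hβ := h.beta_nonneg
    have hL := h.L_nonneg
    have hγ : 0 ≤ γ := norm_nonneg _
    have f : ε * (R * (β * (1 + L) * R + γ)) ≤
        ε ^ (1 / 4 : ℝ) * (R * (β * (1 + L) * R + γ)) := by gcongr
    have g₁ : 0 ≤ ε * R * (β * L * R) := by positivity
    have g₂ : 0 ≤ ε * R * γ := by positivity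
    rw [e]
    nlinarith

end PerfProblem

/-! ## Ellipsoids -/

/-- The ellipsoid with centre `c` and shape matrix `B`. -/
def ellipsoid {d : ℕ} (c : Vec d) (B : Matrix (Fin d) (Fin d) ℝ) : Set (Vec d) :=
  (fun u => c + Matrix.toEuclideanLin B u) '' Metric.closedBall 0 1

namespace ellipsoid

variable {d : ℕ}

/-- Shift of the centre in an ellipsoid step. -/
def shift (d : ℕ) : ℝ := 1 / (d + 2)

/-- Contraction of the ellipsoid in the direction of the cut. -/
def shrink (d : ℕ) : ℝ := 1 - 1 / (d + 2)

/-- Expansion of the ellipsoid in the directions orthogonal to the cut. -/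
def stretch (d : ℕ) : ℝ := 1 + 1 / ((d + 1) * (d + 1))

theorem shrink_pos : 0 < shrink d := by
  rw [shrink, sub_pos, div_lt_one (by positivity)]
  linarith [(Nat.cast_nonneg d : (0 : ℝ) ≤ d)]

theorem stretch_pos : 0 < stretch d := by unfold stretch; positivity

/-- The direction of the cut with normal `g` in the coordinates of the ellipsoid. -/
def dir (B : Matrix (Fin d) (Fin d) ℝ) (g : Vec d) : Vec d :=
  Matrix.toEuclideanLin B.transpose g

theorem inner_dir (B : Matrix (Fin d) (Fin d) ℝ) (g u : Vec d) :
    inner ℝ g (Matrix.toEuclideanLin B u) = inner ℝ (dir B g) u := by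
  rw [dir, ← Matrix.conjTranspose_eq_transpose_of_trivial,
    Matrix.toEuclideanLin_conjTranspose_eq_adjoint, LinearMap.adjoint_inner_left]

/-- The vector by which the centre moves, up to the factor `shift d`. -/
def step (B : Matrix (Fin d) (Fin d) ℝ) (g : Vec d) : Vec d :=
  ‖dir B g‖⁻¹ • Matrix.toEuclideanLin B (dir B g)

/-- The shape matrix after a cut with normal `g`. -/
def nextShape (B : Matrix (Fin d) (Fin d) ℝ) (g : Vec d) : Matrix (Fin d) (Fin d) ℝ :=
  fun i j => stretch d * B i j + (shrink d - stretch d) * (step B g i * dir B g j / ‖dir B g‖)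

/-- With `e` the unit vector along `dir B g`, the update is `B` after the map that scales `e` by
`shrink d` and its orthogonal complement by `stretch d`. Updating this factor, rather than a
quadratic form, requires no inverse and no positivity. -/
theorem toEuclideanLin_nextShape (B : Matrix (Fin d) (Fin d) ℝ) (g u : Vec d) :
    Matrix.toEuclideanLin (nextShape B g) u = Matrix.toEuclideanLin B
      (stretch d • u + ((shrink d - stretch d) * (inner ℝ (dir B g) u / ‖dir B g‖ ^ 2)) •
        dir B g) := by
  rw [map_add, map_smul, map_smul]
  ext i
  have hs : step B g i = ‖dir B g‖⁻¹ * Matrix.toEuclideanLin B (dir B g) i := by simp [step]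
  have hin : inner ℝ (dir B g) u = ∑ j, dir B g j * u j := by
    simp [PiLp.inner_apply, mul_comm]
  have hB : Matrix.toEuclideanLin B u i = ∑ j, B i j * u j := by
    simp [Matrix.toLpLin_apply, Matrix.mulVec, dotProduct]
  have hN : Matrix.toEuclideanLin (nextShape B g) u i = ∑ j, nextShape B g i j * u j := by
    simp [Matrix.toLpLin_apply, Matrix.mulVec, dotProduct]
  rw [hN]
  simp only [PiLp.add_apply, PiLp.smul_apply, smul_eq_mul]
  rw [hB, hin, Finset.mul_sum, Finset.sum_div, Finset.mul_sum, Finset.sum_mul,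
    ← Finset.sum_add_distrib]
  refine Finset.sum_congr rfl fun j _ => ?_
  rw [nextShape, hs]
  ring

/-- Here `s` is the coordinate along the cut of a point of the unit half ball. The parameters are
the classical ones for a central cut in dimension `n = d + 1`, which avoids the degenerate dimension
one, with the stretch `n / √(n ^ 2 - 1)` rounded up to the rational `1 + 1 / n ^ 2`. The left side
is at most `1 + 2 (n + 1) s (s + 1) / n ^ 2`, and `s (s + 1) ≤ 0`. -/
theorem stretch_condition (hd : 0 < d) {s : ℝ} (h₀ : s ≤ 0) (h₁ : -1 ≤ s) :
    (1 - s ^ 2) / stretch d ^ 2 + (s + shift d) ^ 2 / shrink d ^ 2 ≤ 1 := by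
  have hn : (2 : ℝ) ≤ (d : ℝ) + 1 := by
    have : (1 : ℝ) ≤ d := by exact_mod_cast hd
    linarith
  obtain ⟨n, hn'⟩ : ∃ n : ℝ, n = (d : ℝ) + 1 := ⟨_, rfl⟩
  have ha : stretch d = 1 + 1 / (n * n) := by rw [stretch, hn']
  have hb : shrink d = n / (n + 1) := by rw [shrink, hn']; field_simp; ring
  have hk : shift d = 1 / (n + 1) := by rw [shift, hn']; congr 1; ring
  rw [← hn'] at hn
  have hn0 : 0 < n := by linarith
  have h₂ : (s + shift d) ^ 2 / shrink d ^ 2 = (s * (n + 1) + 1) ^ 2 / n ^ 2 := by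
    rw [hb, hk]; field_simp
  have h₃ : (1 - s ^ 2) / stretch d ^ 2 ≤ (1 - s ^ 2) * (1 - 1 / n ^ 2) := by
    rw [div_eq_mul_inv]
    refine mul_le_mul_of_nonneg_left ?_ (by nlinarith)
    rw [ha, inv_le_iff_one_le_mul₀ (by positivity)]
    have hx : 1 / (n * n) ≤ 1 / 4 := one_div_le_one_div_of_le (by norm_num) (by nlinarith)
    have hx' : 1 / n ^ 2 = 1 / (n * n) := by rw [sq]
    have hx0 : 0 < 1 / (n * n) := by positivity
    rw [hx']
    set x := 1 / (n * n)
    nlinarith [mul_nonneg hx0.le (sub_nonneg.2 hx), mul_pos hx0 hx0]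
  have h₄ : (1 - s ^ 2) * (1 - 1 / n ^ 2) + (s * (n + 1) + 1) ^ 2 / n ^ 2 =
      1 + 2 * (n + 1) * (s * (s + 1)) / n ^ 2 := by field_simp; ring
  have h₅ : 2 * (n + 1) * (s * (s + 1)) / n ^ 2 ≤ 0 :=
    div_nonpos_of_nonpos_of_nonneg
      (mul_nonpos_of_nonneg_of_nonpos (by linarith) (by nlinarith)) (by positivity)
  linarith

/-- The ellipsoid step: the half of the ellipsoid that survives a cut through the centre lies in
the next ellipsoid. -/
theorem subset_next (hd : 0 < d) (c g : Vec d) (B : Matrix (Fin d) (Fin d) ℝ) (hv : dir B g ≠ 0) :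
    ellipsoid c B ∩ {y | inner ℝ g (y - c) ≤ 0} ⊆
      ellipsoid (c - shift d • step B g) (nextShape B g) := by
  rintro _ ⟨⟨u, hu, rfl⟩, hcut⟩
  have hu1 : ‖u‖ ≤ 1 := mem_closedBall_zero_iff.1 hu
  simp only [Set.mem_ofPred_eq, add_sub_cancel_left, inner_dir] at hcut
  set v := dir B g with hvdef
  have hN : 0 < ‖v‖ := norm_pos_iff.2 hv
  set e := ‖v‖⁻¹ • v with he
  have he1 : ‖e‖ = 1 := by rw [he, norm_smul, norm_inv, norm_norm, inv_mul_cancel₀ hN.ne']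
  set s := inner ℝ e u with hs
  have hs0 : s ≤ 0 := by
    rw [hs, he, real_inner_smul_left]
    exact mul_nonpos_of_nonneg_of_nonpos (by positivity) hcut
  have hs1 : -1 ≤ s := by
    have := (abs_le.1 (abs_real_inner_le_norm e u)).1
    rw [he1, one_mul] at this
    linarith
  have ha := (stretch_pos (d := d)).ne'
  have hb := (shrink_pos (d := d)).ne'
  -- The point `u` seen from the new centre `-shift d • e`, with each component divided by its
  -- semi-axis.
  refine ⟨(stretch d)⁻¹ • (u - s • e) + ((shrink d)⁻¹ * (s + shift d)) • e, ?_, ?_⟩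
  · rw [mem_closedBall_zero_iff, ← sq_le_one_iff₀ (norm_nonneg _)]
    have hp : inner ℝ (u - s • e) e = 0 := by
      rw [inner_sub_left, real_inner_smul_left, real_inner_self_eq_norm_sq, he1,
        real_inner_comm, ← hs]; ring
    have hq : ‖u - s • e‖ ^ 2 = ‖u‖ ^ 2 - s ^ 2 := by
      rw [norm_sub_sq_real, real_inner_smul_right, real_inner_comm, ← hs, norm_smul, he1,
        Real.norm_eq_abs, mul_one, sq_abs]; ring
    rw [norm_add_sq_real, real_inner_smul_left, real_inner_smul_right, hp, norm_smul, norm_smul,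
      he1, mul_pow, hq]
    have := stretch_condition hd hs0 hs1
    have h2 : (‖u‖ ^ 2 - s ^ 2) / stretch d ^ 2 ≤ (1 - s ^ 2) / stretch d ^ 2 := by
      gcongr; nlinarith [norm_nonneg u]
    refine le_trans (le_of_eq ?_) ((add_le_add_left h2 _).trans this)
    simp only [Real.norm_eq_abs, mul_one, mul_zero, add_zero, sq_abs]
    field_simp
  · have hve : v = ‖v‖ • e := by rw [he, smul_smul, mul_inv_cancel₀ hN.ne', one_smul]
    have hstep : step B g = Matrix.toEuclideanLin B e := by rw [he, map_smul]; rfl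
    set x := (stretch d)⁻¹ • (u - s • e) + ((shrink d)⁻¹ * (s + shift d)) • e with hx
    have hin : inner ℝ v x = ‖v‖ * ((shrink d)⁻¹ * (s + shift d)) := by
      rw [hve, real_inner_smul_left, ← hve, hx, inner_add_right, real_inner_smul_right,
        real_inner_smul_right, inner_sub_right, real_inner_smul_right,
        real_inner_self_eq_norm_sq, he1, ← hs]; ring
    simp only
    rw [toEuclideanLin_nextShape, ← hvdef, hstep, ← map_smul, sub_add, sub_eq_add_neg, ← neg_sub,
      neg_neg, ← map_sub, hin]
    congr 2
    have hcoef : ((shrink d - stretch d) * (‖v‖ * ((shrink d)⁻¹ * (s + shift d)) / ‖v‖ ^ 2)) • v =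
        ((shrink d - stretch d) * ((shrink d)⁻¹ * (s + shift d))) • e := by
      rw [he, smul_smul]; congr 1; field_simp
    rw [hcoef, hx]
    match_scalars <;> field_simp
    ring

/-- The factor by which the volume changes in an ellipsoid step. -/
def rate (d : ℕ) : ℝ := stretch d ^ d * (shrink d / stretch d)

theorem rate_pos : 0 < rate d := by
  have := stretch_pos (d := d); have := shrink_pos (d := d); unfold rate; positivity

/-- With `x = 1 / (d + 1)`, the stretched directions contribute at most `exp (d x ^ 2)`. The
remaining factor is `1 / ((1 + x)(1 + x ^ 2)) ≤ exp (-x)`, and `d x ^ 2 - x = -x ^ 2`. -/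
theorem rate_le : rate d ≤ Real.exp (-(1 / (d + 1) ^ 2)) := by
  set x : ℝ := 1 / (d + 1) with hx
  have hx0 : 0 < x := by positivity
  have hx1 : x ≤ 1 := by
    rw [hx, div_le_one (by positivity)]; linarith [(Nat.cast_nonneg d : (0 : ℝ) ≤ d)]
  have ha : stretch d = 1 + x ^ 2 := by rw [stretch, hx]; field_simp
  have hb : shrink d / stretch d = 1 / (1 + x + x ^ 2 + x ^ 3) := by
    rw [ha, shrink, hx]; field_simp; ring
  have h₁ : stretch d ^ d ≤ Real.exp (d * x ^ 2) := by
    rw [Real.exp_nat_mul]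
    refine pow_le_pow_left₀ stretch_pos.le ?_ d
    rw [ha]; linarith [Real.add_one_le_exp (x ^ 2)]
  have h₂ : shrink d / stretch d ≤ Real.exp (-x) := by
    rw [hb, Real.exp_neg, ← one_div]
    refine one_div_le_one_div_of_le (Real.exp_pos _) ?_
    have := (abs_le.1 (Real.abs_exp_sub_one_sub_id_le (by rwa [abs_of_pos hx0] : |x| ≤ 1))).2
    have : 0 < x ^ 3 := by positivity
    linarith
  have h₃ : (d : ℝ) * x ^ 2 + -x = -(1 / (d + 1) ^ 2) := by rw [hx]; field_simp; ring
  rw [← h₃, Real.exp_add, rate]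
  exact mul_le_mul h₁ h₂ (div_pos shrink_pos stretch_pos).le (Real.exp_pos _).le

/-- The update is `B` composed with a multiple of a transvection `u ↦ u + f u • v`, whose
determinant `1 + f v` equals `shrink d / stretch d`. -/
theorem det_nextShape (B : Matrix (Fin d) (Fin d) ℝ) (g : Vec d) (hv : dir B g ≠ 0) :
    (nextShape B g).det = B.det * rate d := by
  have ha := (stretch_pos (d := d)).ne'
  have hN : ‖dir B g‖ ≠ 0 := norm_ne_zero_iff.2 hv
  let f : Module.Dual ℝ (Vec d) :=
    ((shrink d / stretch d - 1) / ‖dir B g‖ ^ 2) • (innerₛₗ ℝ (dir B g))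
  have key : Matrix.toEuclideanLin (nextShape B g) =
      Matrix.toEuclideanLin B ∘ₗ (stretch d • LinearMap.transvection f (dir B g)) := by
    refine LinearMap.ext fun u => ?_
    rw [toEuclideanLin_nextShape]
    simp only [LinearMap.comp_apply, LinearMap.smul_apply, LinearMap.transvection.apply, smul_add]
    congr 2
    rw [smul_smul]
    congr 1
    simp [f]
    field_simp
  have h := congrArg LinearMap.det key
  rw [LinearMap.det_comp, LinearMap.det_smul, LinearMap.transvection.det] at h
  have hdet : ∀ A : Matrix (Fin d) (Fin d) ℝ, LinearMap.det (Matrix.toEuclideanLin A) = A.det :=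
    fun A => by simp
  rw [hdet, hdet] at h
  rw [h, rate]
  simp [f]
  left; left
  field_simp
  ring

theorem dir_ne_zero {B : Matrix (Fin d) (Fin d) ℝ} (hB : B.det ≠ 0) {g : Vec d} (hg : g ≠ 0) :
    dir B g ≠ 0 := by
  intro h
  have hBt : B.transpose.det ≠ 0 := by rwa [Matrix.det_transpose]
  have : Matrix.mulVec B.transpose g.ofLp = 0 := by
    have := congrArg WithLp.ofLp h
    simpa [dir, Matrix.toLpLin_apply] using this
  have := Matrix.eq_zero_of_mulVec_eq_zero hBt this
  exact hg (by ext i; simp [this])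

/-- An ellipsoid that contains a ball has at least its volume. -/
theorem pow_le_det {c z : Vec d} {B : Matrix (Fin d) (Fin d) ℝ} {τ : ℝ} (hτ : 0 ≤ τ)
    (h : Metric.closedBall z τ ⊆ ellipsoid c B) : τ ^ d ≤ |B.det| := by
  have hv := measure_mono (μ := (volume : Measure (Vec d))) h
  have e : ellipsoid c B = (fun x => c + x) '' (Matrix.toEuclideanLin B '' Metric.closedBall 0 1) := by
    rw [ellipsoid, Set.image_image]
  rw [e, Set.image_add_left, measure_preimage_add, Measure.addHaar_image_linearMap,
    Measure.addHaar_closedBall _ _ hτ, Measure.addHaar_closedBall _ _ zero_le_one,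
    ← mul_assoc, ← ENNReal.ofReal_mul (abs_nonneg _)] at hv
  have h0 : volume (Metric.ball (0 : Vec d) 1) ≠ 0 := (Metric.measure_ball_pos _ _ one_pos).ne'
  have h1 : volume (Metric.ball (0 : Vec d) 1) ≠ ⊤ := measure_ball_lt_top.ne
  rw [ENNReal.mul_le_mul_iff_left h0 h1, ENNReal.ofReal_le_ofReal_iff (by positivity)] at hv
  simpa using hv

theorem closedBall_subset_diagonal {R : ℝ} (hR : 0 < R) {B : Matrix (Fin d) (Fin d) ℝ}
    (hB : B = R • 1) : Metric.closedBall 0 R ⊆ ellipsoid 0 B := by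
  intro x hx
  rw [mem_closedBall_zero_iff] at hx
  refine ⟨R⁻¹ • x, ?_, ?_⟩
  · rw [mem_closedBall_zero_iff, norm_smul, norm_inv, Real.norm_eq_abs, abs_of_pos hR,
      inv_mul_le_iff₀ hR]; simpa using hx
  · subst hB
    ext i
    simp [hR.ne']

/-- Bound for the number of ellipsoid steps. -/
theorem steps_le {c z : Vec d} {B : Matrix (Fin d) (Fin d) ℝ} {τ R : ℝ} {k : ℕ} (hτ : 0 < τ)
    (hR : 0 < R) (h : Metric.closedBall z τ ⊆ ellipsoid c B) (hdet : B.det = R ^ d * rate d ^ k) :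
    (k : ℝ) ≤ (d + 1) ^ 2 * (d * Real.log (R / τ)) := by
  have h₁ := pow_le_det hτ.le h
  have hr := rate_pos (d := d)
  rw [hdet, abs_of_pos (by positivity)] at h₁
  have h₂ := Real.log_le_log (by positivity) h₁
  rw [Real.log_mul (by positivity) (by positivity), Real.log_pow, Real.log_pow, Real.log_pow] at h₂
  have h₃ : Real.log (rate d) ≤ -(1 / (d + 1) ^ 2) := by
    simpa using Real.log_le_log hr rate_le
  have h₄ := mul_le_mul_of_nonneg_left h₃ (Nat.cast_nonneg (α := ℝ) k)
  rw [Real.log_div hR.ne' hτ.ne']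
  have h₅ : (k : ℝ) * (1 / (d + 1) ^ 2) ≤ d * (Real.log R - Real.log τ) := by linarith
  rw [mul_one_div, div_le_iff₀ (by positivity)] at h₅
  linarith

end ellipsoid

/-! ## Program logic -/

/-- Started in `s`, the program `p` halts after at most `C` steps in a store that satisfies `Q`. -/
def Does {d : ℕ} (O : Oracles d) (p : Program) (s : Store) (C : ℕ) (Q : Store → Prop) : Prop :=
  ∃ s' t, Run O p s s' t ∧ t ≤ C ∧ Q s'

/-- The stores `s` and `s'` agree, except on the matrices in `A` and the index registers in `I`. -/
structure Agree (A I : Finset ℕ) (s s' : Store) : Prop where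
  mem : ∀ a ∉ A, s'.mem a = s.mem a
  idx : ∀ r ∉ I, s'.idx r = s.idx r

namespace Agree

variable {A I A' I' : Finset ℕ} {s s' s'' : Store}

theorem mono (h : Agree A I s s') (hA : A ⊆ A') (hI : I ⊆ I') : Agree A' I' s s' :=
  ⟨fun a ha => h.mem a fun h' => ha (hA h'), fun r hr => h.idx r fun h' => hr (hI h')⟩

theorem trans (h : Agree A I s s') (h' : Agree A I s' s'') : Agree A I s s'' :=
  ⟨fun a ha => (h'.mem a ha).trans (h.mem a ha), fun r hr => (h'.idx r hr).trans (h.idx r hr)⟩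

theorem vec_eq (h : Agree A I s s') {a : ℕ} (ha : a ∉ A) (d : ℕ) : s'.vec d a = s.vec d a := by
  simp [Store.vec, h.mem a ha]

theorem setIdx (s : Store) (i v : ℕ) : Agree ∅ {i} s (s.setIdx i v) :=
  ⟨fun _ _ => rfl, fun r hr => by
    rw [Finset.mem_singleton] at hr; simp [Store.setIdx, Function.update_of_ne hr]⟩

theorem setCell (s : Store) (a i j : ℕ) (v : ℝ) : Agree {a} ∅ s (s.setCell a i j v) :=
  ⟨fun a' ha => by rw [Finset.mem_singleton] at ha; simp [Store.setCell, ha], fun _ _ => rfl⟩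

theorem setVec {d : ℕ} (s : Store) (a : ℕ) (v : Vec d) : Agree {a} ∅ s (s.setVec a v) :=
  ⟨fun a' ha => by rw [Finset.mem_singleton] at ha; simp [Store.setVec, ha], fun _ _ => rfl⟩

end Agree

namespace Store

theorem vec_setVec {d : ℕ} (s : Store) (a : ℕ) (v : Vec d) : (s.setVec a v).vec d a = v := by
  ext i; simp [vec, setVec]

@[simp] theorem idx_setIdx_same (s : Store) (i v : ℕ) : (s.setIdx i v).idx i = v := by
  simp [setIdx]

theorem idx_setIdx_of_ne (s : Store) {i j : ℕ} (v : ℕ) (h : j ≠ i) :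
    (s.setIdx i v).idx j = s.idx j := by
  simp [setIdx, Function.update_of_ne h]

@[simp] theorem mem_setIdx (s : Store) (i v : ℕ) : (s.setIdx i v).mem = s.mem := rfl

@[simp] theorem mem_setCell_same (s : Store) (a i j : ℕ) (v : ℝ) :
    (s.setCell a i j v).mem a i j = v := by simp [setCell]

theorem mem_setCell_of_ne (s : Store) {a i j i' j' : ℕ} (v : ℝ) (h : i' ≠ i ∨ j' ≠ j) :
    (s.setCell a i j v).mem a i' j' = s.mem a i' j' := by
  simp only [setCell]; rw [if_neg]; tauto

end Store

namespace Does

variable {d : ℕ} {O : Oracles d} {p q : Program} {s : Store} {C C' : ℕ} {Q Q' : Store → Prop}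

theorem mono (h : Does O p s C Q) (hC : C ≤ C') (hQ : ∀ s', Q s' → Q' s') : Does O p s C' Q' := by
  obtain ⟨s', t, hr, ht, hq⟩ := h
  exact ⟨s', t, hr, ht.trans hC, hQ s' hq⟩

theorem seq (h : Does O p s C Q) (h' : ∀ s', Q s' → Does O q s' C' Q') :
    Does O (.seq p q) s (C + C') Q' := by
  obtain ⟨s', t, hr, ht, hq⟩ := h
  obtain ⟨s'', t', hr', ht', hq'⟩ := h' s' hq
  exact ⟨s'', t + t', hr.seq hr', by omega, hq'⟩

theorem skip (h : Q s) : Does O .skip s 1 Q := ⟨s, 1, .skip s, le_rfl, h⟩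

theorem idxIncr {i : ℕ} (h : Q (s.setIdx i (s.idx i + 1))) : Does O (.idxIncr i) s 1 Q :=
  ⟨_, 1, .idxIncr i s, le_rfl, h⟩

theorem idxZero {i : ℕ} (h : Q (s.setIdx i 0)) : Does O (.idxZero i) s 1 Q :=
  ⟨_, 1, .idxZero i s, le_rfl, h⟩

theorem assign {a i j : ℕ} {e : RExpr} (h : Q (s.setCell a (s.idx i) (s.idx j) (e.eval s))) :
    Does O (.assign a i j e) s (e.cost + 1) Q :=
  ⟨_, _, .assign a i j e s, le_rfl, h⟩

theorem askRRM (O : Oracles d) (a b : ℕ) (s : Store) : Does O (.askRRM a b) s (d + 1)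
    fun s' => s'.vec d b = O.rrm (s.vec d a) ∧ Agree {b} ∅ s s' :=
  ⟨_, _, .askRRM a b s, le_rfl, s.vec_setVec b _, .setVec s b _⟩

theorem askDomain (O : Oracles d) (a b : ℕ) (s : Store) : Does O (.askDomain a b) s (d + 1)
    fun s' => s'.vec d b = O.domain (s.vec d a) ∧ Agree {b} ∅ s s' :=
  ⟨_, _, .askDomain a b s, le_rfl, s.vec_setVec b _, .setVec s b _⟩

theorem branch {c : Test} (h : c.holds s → Does O p s C Q) (h' : ¬ c.holds s → Does O q s C Q) :
    Does O (.branch c p q) s (c.cost + C) Q := by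
  by_cases hc : c.holds s
  · obtain ⟨s', t, hr, ht, hq⟩ := h hc
    exact ⟨s', _, .branch_true hc hr, by omega, hq⟩
  · obtain ⟨s', t, hr, ht, hq⟩ := h' hc
    exact ⟨s', _, .branch_false hc hr, by omega, hq⟩

/-- A loop halts if it runs through states of an invariant with bounded counter until its test
fails. -/
theorem loop {c : Test} (Inv : ℕ → Store → Prop) (N : ℕ)
    (step : ∀ k s, Inv k s → k ≤ N ∧ c.holds s ∧
      Does O p s C fun s' => Inv (k + 1) s' ∨ (¬ c.holds s' ∧ Q s')) {k : ℕ} (h : Inv k s) :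
    Does O (.loop c p) s ((N + 1 - k) * (c.cost + C) + c.cost) Q := by
  obtain ⟨n, hn⟩ : ∃ n, n = N + 1 - k := ⟨_, rfl⟩
  rw [← hn]
  induction n generalizing k s with
  | zero => have := (step k s h).1; omega
  | succ n ih =>
    obtain ⟨hk, hc, s', t, hr, ht, hI | ⟨hc', hq⟩⟩ := step k s h
    · obtain ⟨s'', t', hr', ht', hq'⟩ := ih hI (by omega)
      refine ⟨s'', _, .loop_step hc hr hr', ?_, hq'⟩
      rw [add_mul]; omega
    · refine ⟨s', _, .loop_step hc hr (.loop_done hc'), ?_, hq⟩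
      rw [add_mul]; have := Nat.zero_le (n * (c.cost + C)); omega

end Does

/-! ### Counted loops, sums and entrywise assignments as programs -/

namespace Program

/-- Runs `p` for all values of the index register `i` below the content of register `0`. -/
def forLoop (i : ℕ) (p : Program) : Program :=
  .seq (.idxZero i) (.loop (.idxLt i 0) (.seq p (.idxIncr i)))

/-- Writes `∑ e` to entry `(i, 3)` of matrix `a`, where register `2` is the summation index. -/
def accum (a i : ℕ) (e : RExpr) : Program :=
  .seq (.assign a i 3 (.const 0)) (forLoop 2 (.assign a i 3 (.add (.cell a i 3) e)))

/-- Assigns to all entries of the vector in matrix `a`. -/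
def vecAssign (a : ℕ) (e : RExpr) : Program := forLoop 1 (.assign a 1 3 e)

/-- Assigns to all entries of matrix `a`. -/
def matAssign (a : ℕ) (e : RExpr) : Program := forLoop 1 (forLoop 2 (.assign a 1 2 e))

/-- Writes the squared norm of the vector in matrix `a` to matrix `9`. -/
def normSq (a : ℕ) : Program := accum 9 3 (.mul (.cell a 2 3) (.cell a 2 3))

end Program

/-! ### Correctness and cost of these programs -/

namespace Does

open Program

variable {d : ℕ} {O : Oracles d} {p q : Program} {s : Store} {C : ℕ}

/-- The body must leave the counter alone, so the next invariant is demanded of the store after the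
increment. A pass costs `C` plus test and increment; the final `2` pays for the reset and the
failing test. -/
theorem forLoop {i : ℕ} (hi : i ≠ 0) (Inv : ℕ → Store → Prop) (hd : s.idx 0 = d)
    (h₀ : Inv 0 (s.setIdx i 0))
    (step : ∀ k < d, ∀ s, s.idx 0 = d → s.idx i = k → Inv k s → Does O p s C fun s' =>
      s'.idx 0 = d ∧ s'.idx i = k ∧ Inv (k + 1) (s'.setIdx i (k + 1))) :
    Does O (forLoop i p) s (d * (C + 2) + 2) (Inv d) := by
  have key : ∀ n k s, k + n = d → s.idx 0 = d → s.idx i = k → Inv k s →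
      Does O (.loop (.idxLt i 0) (.seq p (.idxIncr i))) s (n * (C + 2) + 1) (Inv d) := by
    intro n
    induction n with
    | zero =>
      intro k s hk h0 hi' hI
      refine ⟨s, 1, .loop_done ?_, by omega, ?_⟩
      · simp only [Test.holds]; omega
      · have : k = d := by omega
        exact this ▸ hI
    | succ n ih =>
      intro k s hk h0 hi' hI
      obtain ⟨s', t, hr, ht, h1, h2, h3⟩ := step k (by omega) s h0 hi' hI
      obtain ⟨s'', t', hr', ht', hq⟩ := ih (k + 1) (s'.setIdx i (k + 1)) (by omega)
        (by rw [Store.idx_setIdx_of_ne _ _ hi.symm, h1]) (by simp) h3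
      have hinc := Run.idxIncr (O := O) i s'
      rw [h2] at hinc
      have hc : (Test.idxLt i 0).holds s := by simp only [Test.holds]; omega
      refine ⟨s'', _, .loop_step hc (hr.seq hinc) hr', ?_, hq⟩
      rw [add_mul]; simp only [Test.cost]; omega
  have := (idxZero (O := O) (Q := fun s' => s' = s.setIdx i 0) rfl).seq fun s' hs' => by
    subst hs'
    exact key d 0 _ (by omega) (by rw [Store.idx_setIdx_of_ne _ _ hi.symm, hd]) (by simp) h₀
  exact this.mono (by omega) fun _ h => h

/-- A loop over the rows of a matrix. -/
theorem rows {a : ℕ} (P : ℕ → (ℕ → ℝ) → Prop) (hd : s.idx 0 = d)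
    (step : ∀ k < d, ∀ s', Agree {a} {1, 2} s s' → s'.mem a k = s.mem a k → s'.idx 1 = k →
      Does O p s' C fun s'' => Agree {a} {2} s' s'' ∧ (∀ k' ≠ k, s''.mem a k' = s'.mem a k') ∧
        P k (s''.mem a k)) :
    Does O (Program.forLoop 1 p) s (d * (C + 2) + 2) fun s' =>
      Agree {a} {1, 2} s s' ∧ ∀ k < d, P k (s'.mem a k) := by
  refine (forLoop (C := C) one_ne_zero (fun k s' => Agree {a} {1, 2} s s' ∧
    (∀ k' < k, P k' (s'.mem a k')) ∧ ∀ k', k ≤ k' → s'.mem a k' = s.mem a k') hd ?_ ?_).mono le_rfl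
    fun s' h => ⟨h.1, h.2.1⟩
  · exact ⟨(Agree.setIdx s 1 0).mono (by simp) (by decide), by simp, fun _ _ => rfl⟩
  · intro k hk s' h0 h1 ⟨hA, hlt, hge⟩
    refine (step k hk s' hA (hge k le_rfl) h1).mono le_rfl fun s'' ⟨hA', hne, hP⟩ =>
      ⟨by rw [hA'.idx 0 (by decide), h0], by rw [hA'.idx 1 (by decide), h1],
        (hA.trans (hA'.mono (by simp) (by decide))).trans
          ((Agree.setIdx _ 1 _).mono (by simp) (by decide)), fun k' hk' => ?_, fun k' hk' => ?_⟩
    · rw [Store.mem_setIdx]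
      rcases Nat.lt_succ_iff_lt_or_eq.1 hk' with h | rfl
      · rw [hne k' h.ne]; exact hlt k' h
      · exact hP
    · rw [Store.mem_setIdx, hne k' (by omega), hge k' (by omega)]

/-- The summand is evaluated while matrix `a` and the counter change, so `he` fixes its value on all
stores that differ from `s` only there. Register `3` stays zero and serves as the column index of
vectors. -/
theorem accum {a i : ℕ} {e : RExpr} (f : ℕ → ℝ) (hd : s.idx 0 = d) (hz : s.idx 3 = 0) (hi : i ≠ 2)
    (he : ∀ k < d, ∀ s', Agree {a} {2} s s' → s'.idx 2 = k → e.eval s' = f k) :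
    Does O (Program.accum a i e) s (d * (e.cost + 5) + 4) fun s' => Agree {a} {2} s s' ∧
      (∀ k' ≠ s.idx i, s'.mem a k' = s.mem a k') ∧
      s'.mem a (s.idx i) 0 = ∑ k ∈ Finset.range d, f k := by
  have h₁ : Does O (.assign a i 3 (.const 0)) s 2 fun s' => Agree {a} {2} s s' ∧
      (∀ k' ≠ s.idx i, s'.mem a k' = s.mem a k') ∧ s'.mem a (s.idx i) 0 = 0 := by
    refine assign ⟨(Agree.setCell s _ _ _ _).mono le_rfl (by simp), fun k' hk' => ?_, ?_⟩
    · ext j; exact Store.mem_setCell_of_ne _ _ (.inl hk')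
    · rw [hz, Store.mem_setCell_same]; simp [RExpr.eval]
  refine (h₁.seq fun s₁ ⟨hA₁, hne₁, h0₁⟩ => forLoop (C := e.cost + 3) two_ne_zero (fun k s' =>
    Agree {a} {2} s s' ∧ (∀ k' ≠ s.idx i, s'.mem a k' = s.mem a k') ∧
    s'.mem a (s.idx i) 0 = ∑ k ∈ Finset.range k, f k) (by rw [hA₁.idx 0 (by decide), hd]) ?_
    ?_).mono (by rw [add_assoc]; omega) fun _ h => h
  · exact ⟨hA₁.trans ((Agree.setIdx _ _ _).mono (by simp) le_rfl), hne₁, by simpa using h0₁⟩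
  · intro k hk s' h0 h2 ⟨hA, hne, hsum⟩
    have hz' : s'.idx 3 = 0 := by rw [hA.idx 3 (by decide), hz]
    have hi' : s'.idx i = s.idx i := hA.idx i (by simpa using hi)
    refine (assign (O := O) (e := .add (.cell a i 3) e) ?_).mono ?_ fun _ h => h
    · refine ⟨h0, h2, ?_, fun k' hk' => ?_, ?_⟩
      · exact (hA.trans ((Agree.setCell _ _ _ _ _).mono le_rfl (by simp))).trans
          ((Agree.setIdx _ _ _).mono (by simp) le_rfl)
      · rw [Store.mem_setIdx, ← hne k' hk']
        ext j; exact Store.mem_setCell_of_ne _ _ (.inl (by rwa [hi']))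
      · rw [Store.mem_setIdx, hz', hi', Store.mem_setCell_same, Finset.sum_range_succ]
        simp only [RExpr.eval]
        rw [hz', hi', hsum, he k hk s' hA h2]
    · simp only [RExpr.cost]; omega

/-- The premise in `he` that row `k` is still untouched permits in-place updates, where `e` reads
the entry it overwrites. -/
theorem vecAssign {a : ℕ} {e : RExpr} (f : ℕ → ℝ) (hd : s.idx 0 = d) (hz : s.idx 3 = 0)
    (he : ∀ k < d, ∀ s', Agree {a} {1, 2} s s' → s'.mem a k = s.mem a k → s'.idx 1 = k →
      e.eval s' = f k) :
    Does O (Program.vecAssign a e) s (d * (e.cost + 3) + 2) fun s' => Agree {a} {1, 2} s s' ∧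
      ∀ k < d, s'.mem a k 0 = f k := by
  refine rows (C := e.cost + 1) (fun k row => row 0 = f k) hd fun k hk s' hA hk' h1 => assign ?_
  have hz' : s'.idx 3 = 0 := by rw [hA.idx 3 (by decide), hz]
  refine ⟨(Agree.setCell _ _ _ _ _).mono le_rfl (by simp), fun k' hne => ?_, ?_⟩
  · ext j; exact Store.mem_setCell_of_ne _ _ (.inl (by rwa [h1]))
  · rw [h1, hz', Store.mem_setCell_same, he k hk s' hA hk' h1]

theorem matAssign {a : ℕ} {e : RExpr} (f : ℕ → ℕ → ℝ) (hd : s.idx 0 = d)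
    (he : ∀ i < d, ∀ j < d, ∀ s', Agree {a} {1, 2} s s' → s'.mem a i j = s.mem a i j →
      s'.idx 1 = i → s'.idx 2 = j → e.eval s' = f i j) :
    Does O (Program.matAssign a e) s (d * (d * (e.cost + 3) + 4) + 2) fun s' =>
      Agree {a} {1, 2} s s' ∧ ∀ i < d, ∀ j < d, s'.mem a i j = f i j := by
  refine rows (C := d * (e.cost + 3) + 2) (fun i row => ∀ j < d, row j = f i j) hd
    fun i hi s' hA hrow h1 => ?_
  refine (forLoop (C := e.cost + 1) two_ne_zero (fun k s'' => Agree {a} {2} s' s'' ∧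
    (∀ i' ≠ i, s''.mem a i' = s'.mem a i') ∧ (∀ j < k, s''.mem a i j = f i j) ∧
    ∀ j, k ≤ j → s''.mem a i j = s'.mem a i j) (by rw [hA.idx 0 (by decide), hd]) ?_ ?_).mono le_rfl
    fun s'' h => ⟨h.1, h.2.1, h.2.2.1⟩
  · exact ⟨(Agree.setIdx _ _ _).mono (by simp) le_rfl, fun _ _ => rfl, by simp, fun _ _ => rfl⟩
  · intro j hj s'' h0 h2 ⟨hA', hne, hlt, hge⟩
    have h1' : s''.idx 1 = i := by rw [hA'.idx 1 (by decide), h1]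
    refine assign ⟨h0, h2, ?_, fun i' hi' => ?_, fun j' hj' => ?_, fun j' hj' => ?_⟩
    · exact (hA'.trans ((Agree.setCell _ _ _ _ _).mono le_rfl (by simp))).trans
          ((Agree.setIdx _ _ _).mono (by simp) le_rfl)
    · rw [Store.mem_setIdx, ← hne i' hi', h1']
      ext j; exact Store.mem_setCell_of_ne _ _ (.inl hi')
    · rw [Store.mem_setIdx, h1', h2]
      rcases Nat.lt_succ_iff_lt_or_eq.1 hj' with h | rfl
      · rw [Store.mem_setCell_of_ne _ _ (.inr h.ne), hlt j' h]
      · rw [Store.mem_setCell_same]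
        exact he i hi j' hj s'' (hA.trans (hA'.mono le_rfl (by decide)))
          (by rw [hge j' le_rfl, hrow]) h1' h2
    · rw [Store.mem_setIdx, h1', h2, Store.mem_setCell_of_ne _ _ (.inr (by omega)),
        hge j' (by omega)]

theorem normSq {a : ℕ} (ha : a ≠ 9) (hd : s.idx 0 = d) (hz : s.idx 3 = 0) :
    Does O (Program.normSq a) s (d * 8 + 4) fun s' => Agree {9} {2} s s' ∧
      s'.mem 9 0 0 = ‖s.vec d a‖ ^ 2 := by
  refine (accum (e := .mul (.cell a 2 3) (.cell a 2 3)) (fun k => s.mem a k 0 * s.mem a k 0) hd hz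
    (by decide) ?_).mono le_rfl fun s' ⟨hA, _, hsum⟩ => ⟨hA, ?_⟩
  · intro k _ s' hA h2
    simp only [RExpr.eval, h2, hA.idx 3 (by decide), hz, hA.mem a (by simpa using ha)]
  · rw [hz] at hsum
    rw [hsum, EuclideanSpace.real_norm_sq_eq, Finset.sum_range]
    simp [Store.vec, sq]

end Does

/-! ## The ellipsoid algorithm -/

/-- The `d × d` matrix in matrix register `a`. -/
def Store.mat (s : Store) (d a : ℕ) : Matrix (Fin d) (Fin d) ℝ := fun i j => s.mem a i j

namespace Program

/-- Writes the vector of all sums `∑ e` over register `2`, indexed by register `1`, to matrix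
`a`. -/
def rowSums (a : ℕ) (e : RExpr) : Program := forLoop 1 (accum a 1 e)

def shiftExpr : RExpr := .div (.const 1) (.add (.ofIdx 0) (.const 2))

def shrinkExpr : RExpr := .sub (.const 1) shiftExpr

def stretchExpr : RExpr :=
  .add (.const 1) (.div (.const 1)
    (.mul (.add (.ofIdx 0) (.const 1)) (.add (.ofIdx 0) (.const 1))))

/-- One step of the ellipsoid method. Centre and shape are in the matrices `2` and `3`, the normal
of the cut is in matrix `4`. -/
def cut : Program :=
  .seq (rowSums 7 (.mul (.cell 3 2 1) (.cell 4 2 3))) <|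
  .seq (normSq 7) <|
  .seq (rowSums 8 (.div (.mul (.cell 3 1 2) (.cell 7 2 3)) (.sqrt (.cell 9 3 3)))) <|
  .seq (vecAssign 2 (.sub (.cell 2 1 3) (.mul shiftExpr (.cell 8 1 3))))
    (matAssign 3 (.add (.mul stretchExpr (.cell 3 1 2)) (.mul (.sub shrinkExpr stretchExpr)
      (.div (.mul (.cell 8 1 3) (.cell 7 2 3)) (.sqrt (.cell 9 3 3))))))

/-- Computes `c - (1 - ε) G p` in matrix `4`, for the centre `c` and the candidate `p` in the
matrices `2` and `5`, and raises the flag in register `4` if its norm is at most `ε R`. -/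
def residual : Program :=
  .seq (askRRM 5 6) <|
  .seq (vecAssign 4 (.sub (.cell 2 1 3) (.mul (.sub (.const 1) (.cell 0 3 3)) (.cell 6 1 3)))) <|
  .seq (normSq 4) <|
  .branch (.realLe (.cell 9 3 3)
    (.mul (.mul (.cell 0 3 3) (.cell 1 3 3)) (.mul (.cell 0 3 3) (.cell 1 3 3)))) (.idxIncr 4) .skip

/-- Finds the next cut with a separation oracle. -/
def separationQuery : Program :=
  .seq (askDomain 2 4) <|
  .seq (normSq 4) <|
  .branch (.realLe (.cell 9 3 3) (.const 0)) (.seq (vecAssign 5 (.cell 2 1 3)) residual) .skip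

/-- Finds the next cut with a projection oracle. -/
def projectionQuery : Program := .seq (askDomain 2 5) residual

/-- The ellipsoid method with the cuts that are found by `query`. -/
def solver (query : Program) : Program :=
  -- Register `5` becomes the constant one, so `.idxLt 4 5` tests that the success flag is down.
  .seq (.idxIncr 5) <|
  -- The initial store supplies the zero centre and the zero off-diagonal entries; with `R` on the
  -- diagonal the ellipsoid is the ball of radius `R`.
  .seq (forLoop 1 (.assign 3 1 1 (.cell 1 3 3))) <|
  .seq (.loop (.idxLt 4 5) (.seq query (.branch (.idxLt 4 5) cut .skip)))
    (vecAssign 0 (.cell 5 1 3))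

end Program

/-- The registers that hold the input and the constants zero and one are intact. -/
structure Store.Ready (d : ℕ) (ε R : ℝ) (s : Store) : Prop where
  dim : s.idx 0 = d
  zero : s.idx 3 = 0
  one : s.idx 5 = 1
  eps : s.mem 0 0 0 = ε
  radius : s.mem 1 0 0 = R

theorem Store.Ready.of_agree {d : ℕ} {ε R : ℝ} {s s' : Store} {A I : Finset ℕ}
    (h : s.Ready d ε R) (hA : Agree A I s s') (h₀ : 0 ∉ A) (h₁ : 1 ∉ A)
    (hI : 0 ∉ I ∧ 3 ∉ I ∧ 5 ∉ I) : s'.Ready d ε R :=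
  ⟨(hA.idx 0 hI.1).trans h.dim, (hA.idx 3 hI.2.1).trans h.zero, (hA.idx 5 hI.2.2).trans h.one,
    by rw [hA.mem 0 h₀, h.eps], by rw [hA.mem 1 h₁, h.radius]⟩

/-! ### Correctness and cost of the ellipsoid program -/

namespace Does

variable {d : ℕ} {O : Oracles d} {s : Store} {ε R : ℝ}

theorem rowSums {a : ℕ} {e : RExpr} (f : ℕ → ℕ → ℝ) (hd : s.idx 0 = d) (hz : s.idx 3 = 0)
    (he : ∀ i < d, ∀ j < d, ∀ s', Agree {a} {1, 2} s s' → s'.idx 1 = i → s'.idx 2 = j →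
      e.eval s' = f i j) :
    Does O (Program.rowSums a e) s (d * (d * (e.cost + 5) + 6) + 2) fun s' =>
      Agree {a} {1, 2} s s' ∧ ∀ i < d, s'.mem a i 0 = ∑ j ∈ Finset.range d, f i j := by
  refine rows (C := d * (e.cost + 5) + 4) (fun i row => row 0 = ∑ j ∈ Finset.range d, f i j) hd
    fun i hi s' hA _ h1 => ?_
  refine (accum (f i) (by rw [hA.idx 0 (by decide), hd]) (by rw [hA.idx 3 (by decide), hz])
    (by decide) fun j hj s'' hA' h2 => ?_).mono le_rfl fun s'' h => by rwa [h1] at h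
  exact he i hi j hj s'' (hA.trans (hA'.mono le_rfl (by decide)))
    (by rw [hA'.idx 1 (by decide), h1]) h2

-- Direction and step are stored in the matrices `7` and `8` before the old shape is overwritten, so
-- centre and shape are updated in place. A zero direction needs no exception, because program and
-- definitions share the convention that division by zero gives zero.
open ellipsoid in
theorem cut (h : s.Ready d ε R) : Does O Program.cut s (100 * (d + 1) ^ 2) fun s' =>
    Agree {2, 3, 7, 8, 9} {1, 2} s s' ∧
    s'.vec d 2 = s.vec d 2 - shift d • step (s.mat d 3) (s.vec d 4) ∧
    s'.mat d 3 = nextShape (s.mat d 3) (s.vec d 4) := by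
  set B := s.mat d 3 with hB
  set g := s.vec d 4 with hg
  have h1 : Does O (Program.rowSums 7 (.mul (.cell 3 2 1) (.cell 4 2 3))) s
      (d * (d * 8 + 6) + 2) fun s' => Agree {7} {1, 2} s s' ∧ s'.vec d 7 = dir B g := by
    refine (rowSums (fun i j => s.mem 3 j i * s.mem 4 j 0) h.dim h.zero ?_).mono le_rfl
      fun s' ⟨hA, hv⟩ => ⟨hA, ?_⟩
    · intro i _ j _ s' hA h1 h2
      simp only [RExpr.eval, h1, h2, hA.idx 3 (by decide), h.zero, hA.mem 3 (by decide),
        hA.mem 4 (by decide)]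
    · ext i
      simp [Store.vec, hv i i.2, Finset.sum_range, dir, Matrix.toLpLin_apply, Matrix.mulVec,
        dotProduct, hB, hg, Store.mat]
  refine (h1.seq fun s₁ ⟨A₁, v₁⟩ => ?_).mono (C := d * (d * 8 + 6) + 2 + (d * 8 + 4 +
    (d * (d * 11 + 6) + 2 + (d * 12 + 2 + (d * (d * 43 + 4) + 2))))) (by nlinarith)
    fun _ h => h
  have r₁ := h.of_agree A₁ (by decide) (by decide) (by decide)
  refine (normSq (by decide) r₁.dim r₁.zero).seq fun s₂ ⟨A₂, n₂⟩ => ?_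
  have r₂ := r₁.of_agree A₂ (by decide) (by decide) (by decide)
  rw [v₁] at n₂
  have v₂ : s₂.vec d 7 = dir B g := by rw [A₂.vec_eq (by decide), v₁]
  have B₂ : s₂.mem 3 = s.mem 3 := by rw [A₂.mem 3 (by decide), A₁.mem 3 (by decide)]
  have h3 : Does O (Program.rowSums 8 (.div (.mul (.cell 3 1 2) (.cell 7 2 3))
      (.sqrt (.cell 9 3 3)))) s₂ (d * (d * 11 + 6) + 2) fun s' =>
      Agree {8} {1, 2} s₂ s' ∧ s'.vec d 8 = step B g := by
    refine (rowSums (fun i j => s.mem 3 i j * s₂.mem 7 j 0 / ‖dir B g‖) r₂.dim r₂.zero ?_).mono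
      le_rfl fun s' ⟨hA, hv⟩ => ⟨hA, ?_⟩
    · intro i _ j _ s' hA h1 h2
      simp only [RExpr.eval, h1, h2, hA.idx 3 (by decide), r₂.zero, hA.mem 3 (by decide),
        hA.mem 7 (by decide), hA.mem 9 (by decide), B₂, n₂, Real.sqrt_sq (norm_nonneg _)]
    · have e : ∀ j : Fin d, s₂.mem 7 j 0 = dir B g j := fun j => by rw [← v₂]; rfl
      ext i
      simp [Store.vec, hv i i.2, Finset.sum_range, step, Matrix.toLpLin_apply, Matrix.mulVec,
        dotProduct, hB, Store.mat, e, ← Finset.sum_div]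
      ring
  refine h3.seq fun s₃ ⟨A₃, w₃⟩ => ?_
  have r₃ := r₂.of_agree A₃ (by decide) (by decide) (by decide)
  have A₀₃ : Agree {7, 8, 9} {1, 2} s s₃ := ((A₁.mono (by decide) le_rfl).trans
    (A₂.mono (by decide) (by decide))).trans (A₃.mono (by decide) le_rfl)
  have h4 : Does O (Program.vecAssign 2 (.sub (.cell 2 1 3) (.mul Program.shiftExpr (.cell 8 1 3))))
      s₃ (d * 12 + 2) fun s' => Agree {2} {1, 2} s₃ s' ∧
        s'.vec d 2 = s.vec d 2 - shift d • step B g := by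
    refine (vecAssign (fun i => s.mem 2 i 0 - shift d * s₃.mem 8 i 0) r₃.dim r₃.zero ?_).mono
      le_rfl fun s' ⟨hA, hv⟩ => ⟨hA, ?_⟩
    · intro i _ s' hA hi h1
      simp only [Program.shiftExpr, RExpr.eval, h1, hA.idx 3 (by decide), hA.idx 0 (by decide),
        r₃.zero, r₃.dim, hi, hA.mem 8 (by decide), A₀₃.mem 2 (by decide), shift]
      norm_num
    · ext i
      simp [Store.vec, hv i i.2, ← w₃]
  refine h4.seq fun s₄ ⟨A₄, c₄⟩ => ?_
  have r₄ := r₃.of_agree A₄ (by decide) (by decide) (by decide)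
  have A₀₄ : Agree {2, 7, 8, 9} {1, 2} s s₄ :=
    (A₀₃.mono (by decide) le_rfl).trans (A₄.mono (by decide) le_rfl)
  refine (matAssign (fun i j => stretch d * s.mem 3 i j + (shrink d - stretch d) *
    (s₄.mem 8 i 0 * s₄.mem 7 j 0 / ‖dir B g‖)) r₄.dim ?_).mono le_rfl
    fun s' ⟨hA, hM⟩ => ⟨?_, ?_, ?_⟩
  · intro i _ j _ s' hA hij h1 h2
    have n₄ : s₄.mem 9 0 0 = ‖dir B g‖ ^ 2 := by
      rw [A₄.mem 9 (by decide), A₃.mem 9 (by decide), n₂]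
    simp only [Program.shiftExpr, Program.shrinkExpr, Program.stretchExpr, RExpr.eval, h1, h2,
      hA.idx 3 (by decide), hA.idx 0 (by decide), r₄.zero, r₄.dim, hij, hA.mem 8 (by decide),
      hA.mem 7 (by decide), hA.mem 9 (by decide), A₀₄.mem 3 (by decide), n₄,
      Real.sqrt_sq (norm_nonneg _), shrink, stretch]
    norm_num
  · exact (A₀₄.mono (by decide) le_rfl).trans (hA.mono (by decide) le_rfl)
  · rw [hA.vec_eq (by decide), c₄]
  · have e₇ : ∀ j : Fin d, s₄.mem 7 j 0 = dir B g j := fun j => by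
      rw [A₄.mem 7 (by decide), A₃.mem 7 (by decide), ← v₂]; rfl
    have e₈ : ∀ j : Fin d, s₄.mem 8 j 0 = step B g j := fun j => by
      rw [A₄.mem 8 (by decide), ← w₃]; rfl
    ext i j
    simp only [Store.mat, nextShape, hM i i.2 j j.2, e₇, e₈, hB]

theorem residual (h : s.Ready d ε R) (hf : s.idx 4 = 0) (hε : 0 ≤ ε) (hR : 0 ≤ R) :
    Does O Program.residual s (30 * (d + 1)) fun s' => Agree {4, 6, 9} {1, 2, 4} s s' ∧
      s'.vec d 4 = s.vec d 2 - (1 - ε) • O.rrm (s.vec d 5) ∧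
      (s'.idx 4 = 1 ∧ ‖s'.vec d 4‖ ≤ ε * R ∨ s'.idx 4 = 0 ∧ ε * R < ‖s'.vec d 4‖) := by
  refine ((askRRM O 5 6 s).seq fun s₁ ⟨y₁, A₁⟩ => ?_).mono (C := d + 1 + (d * 10 + 2 +
    (d * 8 + 4 + (9 + 1)))) (by omega) fun _ h => h
  have r₁ := h.of_agree A₁ (by decide) (by decide) (by decide)
  have h2 : Does O (Program.vecAssign 4 (.sub (.cell 2 1 3)
      (.mul (.sub (.const 1) (.cell 0 3 3)) (.cell 6 1 3)))) s₁ (d * 10 + 2) fun s' =>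
      Agree {4} {1, 2} s₁ s' ∧ s'.vec d 4 = s.vec d 2 - (1 - ε) • O.rrm (s.vec d 5) := by
    refine (vecAssign (fun i => s.mem 2 i 0 - (1 - ε) * s₁.mem 6 i 0) r₁.dim r₁.zero ?_).mono
      le_rfl fun s' ⟨hA, hv⟩ => ⟨hA, ?_⟩
    · intro i _ s' hA hi h1
      simp only [RExpr.eval, h1, hA.idx 3 (by decide), r₁.zero, hA.mem 2 (by decide),
        hA.mem 6 (by decide), hA.mem 0 (by decide), A₁.mem 2 (by decide), r₁.eps]
      norm_num
    · have e : ∀ i : Fin d, s₁.mem 6 i 0 = O.rrm (s.vec d 5) i := fun i => by rw [← y₁]; rfl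
      ext i
      rw [PiLp.sub_apply, PiLp.smul_apply, ← e]
      exact hv i i.2
  refine h2.seq fun s₂ ⟨A₂, g₂⟩ => ?_
  have r₂ := r₁.of_agree A₂ (by decide) (by decide) (by decide)
  refine (normSq (by decide) r₂.dim r₂.zero).seq fun s₃ ⟨A₃, n₃⟩ => ?_
  have r₃ := r₂.of_agree A₃ (by decide) (by decide) (by decide)
  have A : Agree {4, 6, 9} {1, 2} s s₃ := ((A₁.mono (by decide) (by decide)).trans
    (A₂.mono (by decide) le_rfl)).trans (A₃.mono (by decide) (by decide))
  have f₃ : s₃.idx 4 = 0 := by rw [A.idx 4 (by decide), hf]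
  have g₃ : s₃.vec d 4 = s₂.vec d 4 := A₃.vec_eq (by decide) d
  have hεR := mul_nonneg hε hR
  refine branch (fun hc => idxIncr ⟨?_, ?_, .inl ⟨by simp [f₃], ?_⟩⟩) fun hc => skip ⟨?_, ?_, .inr ⟨f₃, ?_⟩⟩
  · exact (A.mono le_rfl (by decide)).trans ((Agree.setIdx _ _ _).mono (by simp) (by decide))
  · rw [← g₂, ← g₃]; rfl
  · simp only [Test.holds, RExpr.eval, r₃.zero, r₃.eps, r₃.radius, n₃, ← g₃] at hc
    exact abs_le_of_sq_le_sq' (by rwa [sq (ε * R)]) hεR |>.2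
  · exact A.mono le_rfl (by decide)
  · rw [← g₂, ← g₃]
  · simp only [Test.holds, RExpr.eval, r₃.zero, r₃.eps, r₃.radius, n₃, ← g₃, not_le, ← sq] at hc
    exact lt_of_pow_lt_pow_left₀ 2 (norm_nonneg _) hc

/-- The specification of a query: find an acceptable point, or a cut through the current centre
that does not cut into the ball with centre `z` and radius `τ`. -/
def IsQuery (O : Oracles d) (ε R τ : ℝ) (z : Vec d) (good : Vec d → Prop) (query : Program) : Prop :=
  ∀ s, s.Ready d ε R → s.idx 4 = 0 → Does O query s (100 * (d + 1)) fun s' =>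
    Agree {4, 5, 6, 9} {1, 2, 4} s s' ∧ (s'.idx 4 = 1 ∧ good (s'.vec d 5) ∨ s'.idx 4 = 0 ∧
      s'.vec d 4 ≠ 0 ∧ Metric.closedBall z τ ⊆ {y | inner ℝ (s'.vec d 4) (y - s'.vec d 2) ≤ 0})

-- Before every query the ellipsoid contains the ball around `z` and its determinant is exactly `R ^
-- d * rate d ^ k` after `k` cuts. Comparing volumes forces `k ≤ N`, so the flag is raised in time.
open ellipsoid in
theorem solver {τ : ℝ} {z : Vec d} {good : Vec d → Prop} {query : Program}
    (hq : IsQuery O ε R τ z good query) (hτ : 0 < τ) (hR : 0 < R)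
    (hz : Metric.closedBall z τ ⊆ Metric.closedBall 0 R) :
    Does O (Program.solver query) (Store.init d ε R)
      ((⌊((d + 1) ^ 2 * (d * Real.log (R / τ)) : ℝ)⌋₊ + 2) * (300 * (d + 1) ^ 2))
      fun s' => good (s'.vec d 0) := by
  set N := ⌊((d + 1) ^ 2 * (d * Real.log (R / τ)) : ℝ)⌋₊
  set s₀ := Store.init d ε R with hs₀
  have h1 : Does O (.idxIncr 5) s₀ 1 fun s => s.Ready d ε R ∧ s.idx 4 = 0 ∧ s.vec d 2 = 0 ∧
      ∀ i j, s.mem 3 i j = 0 := by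
    refine idxIncr ⟨⟨?_, ?_, ?_, ?_, ?_⟩, ?_, ?_, ?_⟩ <;> simp [s₀, Store.init, Store.setIdx]
    ext i; simp [Store.vec]
  refine (h1.seq fun s₁ ⟨r₁, f₁, c₁, B₁⟩ => ?_).mono (C := 1 + (d * 4 + 2 + ((N + 1 - 0) *
    (1 + (100 * (d + 1) + (1 + 100 * (d + 1) ^ 2))) + 1 + (d * 4 + 2))))
    (by rw [Nat.sub_zero]; nlinarith [Nat.zero_le (N * d), Nat.zero_le (N * d * d)]) fun _ h => h
  have h2 : Does O (Program.forLoop 1 (.assign 3 1 1 (.cell 1 3 3))) s₁ (d * 4 + 2) fun s =>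
      Agree {3} {1, 2} s₁ s ∧ s.mat d 3 = R • (1 : Matrix (Fin d) (Fin d) ℝ) := by
    refine (rows (C := 2) (a := 3) (fun i row => ∀ j < d, row j = if i = j then R else 0) r₁.dim
      fun i hi s hA hrow h1 => assign ⟨?_, fun k hk => ?_, fun j hj => ?_⟩).mono le_rfl
      fun s ⟨hA, hM⟩ => ⟨hA, ?_⟩
    · ext i j
      simp [Store.mat, hM i i.2 j j.2, Matrix.one_apply, Fin.ext_iff]
    · exact (Agree.setCell _ _ _ _ _).mono le_rfl (by simp)
    · ext j; exact Store.mem_setCell_of_ne _ _ (.inl (by rwa [h1]))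
    · rw [h1]
      by_cases hij : i = j
      · subst hij
        rw [Store.mem_setCell_same, if_pos rfl]
        simp only [RExpr.eval, hA.idx 3 (by decide), r₁.zero, hA.mem 1 (by decide), r₁.radius]
      · rw [Store.mem_setCell_of_ne _ _ (.inr (Ne.symm hij)), hrow, B₁, if_neg hij]
  refine h2.seq fun s₂ ⟨A₂, B₂⟩ => ?_
  have r₂ := r₁.of_agree A₂ (by decide) (by decide) (by decide)
  let Inv : ℕ → Store → Prop := fun k s => s.Ready d ε R ∧ s.idx 4 = 0 ∧
    Metric.closedBall z τ ⊆ ellipsoid (s.vec d 2) (s.mat d 3) ∧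
    (s.mat d 3).det = R ^ d * rate d ^ k
  refine (loop (Q := fun s => good (s.vec d 5) ∧ s.Ready d ε R) Inv N (k := 0) ?_ ?_).seq
    (C' := d * 4 + 2) fun s₃ ⟨hg, r₃⟩ => ?_
  · intro k s ⟨r, f, hE, hdet⟩
    refine ⟨Nat.le_floor (steps_le hτ hR hE hdet), by simp [Test.holds, f, r.one], ?_⟩
    refine (hq s r f).seq fun s' ⟨A', h'⟩ => ?_
    have r' := r.of_agree A' (by decide) (by decide) (by decide)
    have hc' : s'.vec d 2 = s.vec d 2 := A'.vec_eq (by decide) d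
    have hB' : s'.mat d 3 = s.mat d 3 := by
      ext i j; simp only [Store.mat, A'.mem 3 (by decide)]
    refine branch (fun hc => ?_) fun hc => ?_
    · have hc : s'.idx 4 < s'.idx 5 := hc
      rw [r'.one] at hc
      obtain ⟨h₁, -⟩ | ⟨f', hg0, hcut⟩ := h'
      · omega
      -- In dimension zero there is no nonzero normal, so the query cannot have returned a cut.
      have hd : 0 < d := by
        rcases Nat.eq_zero_or_pos d with rfl | hd
        · exact absurd (Subsingleton.elim _ _) hg0
        · exact hd
      have hr := rate_pos (d := d)
      -- The determinant is a product of positive powers, so the shape is invertible.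
      have hv := dir_ne_zero (B := s'.mat d 3) (by rw [hB', hdet]; positivity) hg0
      refine (cut r').mono le_rfl fun s'' ⟨A'', c'', B''⟩ => .inl ⟨r'.of_agree A'' (by decide)
        (by decide) (by decide), by rw [A''.idx 4 (by decide), f'], ?_, ?_⟩
      · rw [c'', B'']
        refine (Set.subset_inter ?_ hcut).trans (subset_next hd _ _ _ hv)
        rwa [hc', hB']
      · rw [B'', det_nextShape _ _ hv, hB', hdet, pow_succ]; ring
    · have hf : ¬ s'.idx 4 < s'.idx 5 := hc
      rw [r'.one] at hf
      obtain ⟨h₁, hgood⟩ | ⟨f', -⟩ := h'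
      · exact (skip (Q := fun s'' => s'' = s') rfl).mono (Nat.succ_le_of_lt (by positivity)) fun s'' e => by
          subst e; exact .inr ⟨hc, hgood, r'⟩
      · omega
  · refine ⟨r₂, by rw [A₂.idx 4 (by decide), f₁], ?_, ?_⟩
    · rw [A₂.vec_eq (by decide), c₁]
      exact hz.trans (closedBall_subset_diagonal hR B₂)
    · rw [B₂]; simp
  · refine (vecAssign (fun i => s₃.mem 5 i 0) r₃.dim r₃.zero ?_).mono le_rfl
      fun s' ⟨hA, hv⟩ => ?_
    · intro i _ s' hA _ h1
      simp only [RExpr.eval, h1, hA.idx 3 (by decide), r₃.zero, hA.mem 5 (by decide)]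
    · have : s'.vec d 0 = s₃.vec d 5 := by ext i; simp [Store.vec, hv i i.2]
      rwa [this]

end Does

/-! ## The queries find points close to a fixed point -/

theorem exists_fixedPoint_of_norm_sub_le {d : ℕ} {T : Vec d → Vec d} {K : Set (Vec d)} {q : ℝ}
    (hK : IsClosed K) (hne : K.Nonempty) (hT : Set.MapsTo T K K) (hq : q < 1)
    (hl : ∀ x ∈ K, ∀ y ∈ K, ‖T x - T y‖ ≤ q * ‖x - y‖) : ∃ z ∈ K, T z = z := by
  obtain ⟨x, hx⟩ := hne
  have hc : ContractingWith q.toNNReal (hT.restrict T K K) := by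
    refine ⟨by rw [← NNReal.coe_lt_coe, Real.coe_toNNReal']; simpa using hq,
      LipschitzWith.of_dist_le_mul fun a b => ?_⟩
    rw [Subtype.dist_eq, Subtype.dist_eq, dist_eq_norm, dist_eq_norm]
    refine (hl a a.2 b b.2).trans (mul_le_mul_of_nonneg_right ?_ (norm_nonneg _))
    exact Real.le_coe_toNNReal q
  obtain ⟨z, hz, hfix, -⟩ := hc.exists_fixedPoint' hK.isComplete hT hx (edist_ne_top _ _)
  exact ⟨z, hz, hfix⟩

/-- A deep cut towards the fixed point `z` of a contraction that maps `x` to `t`. -/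
theorem closedBall_subset_halfspace {d : ℕ} {x z t : Vec d} {ε R : ℝ} (hε : 0 < ε)
    (ht : ‖t - z‖ ≤ (1 - ε ^ 2) * ‖x - z‖) (hg : ε * R < ‖x - t‖) :
    Metric.closedBall z (ε ^ 3 * R / 4) ⊆ {y | inner ℝ (x - t) (y - x) ≤ 0} := by
  intro y hy
  rw [mem_closedBall_iff_norm] at hy
  rw [Set.mem_ofPred_eq]
  set D := ‖x - z‖
  have hD : 0 ≤ D := norm_nonneg _
  have h₁ : ‖x - t‖ ≤ 2 * D := by
    have : ‖x - t‖ ≤ ‖x - z‖ + ‖t - z‖ := by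
      rw [← norm_neg (t - z)]; refine le_trans (le_of_eq ?_) (norm_add_le _ _); congr 1; abel
    nlinarith [mul_nonneg (sq_nonneg ε) hD]
  -- This is the depth of `z` behind the cut. Within the ball the inner product varies by at most `2
  -- D · ε ^ 3 R / 4`, and `ε R < 2 D` makes this at most `ε ^ 2 D ^ 2`; this determines the radius.
  have h₂ : ε ^ 2 * D ^ 2 ≤ inner ℝ (x - t) (x - z) := by
    have e : inner ℝ (x - t) (x - z) = D ^ 2 - inner ℝ (t - z) (x - z) := by
      rw [← real_inner_self_eq_norm_sq, ← inner_sub_left]; congr 1; abel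
    have := (real_inner_le_norm (t - z) (x - z)).trans (mul_le_mul_of_nonneg_right ht hD)
    rw [e]; nlinarith
  have h₃ : inner ℝ (x - t) (y - z) ≤ 2 * D * (ε ^ 3 * R / 4) :=
    (real_inner_le_norm _ _).trans (mul_le_mul h₁ hy (norm_nonneg _) (by positivity))
  have e : inner ℝ (x - t) (y - x) = inner ℝ (x - t) (y - z) - inner ℝ (x - t) (x - z) := by
    rw [← inner_sub_right]; congr 1; abel
  have h₄ : ε ^ 2 * D * (ε * R) ≤ ε ^ 2 * D * (2 * D) :=
    mul_le_mul_of_nonneg_left (hg.le.trans h₁) (by positivity)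
  rw [e]; nlinarith

/-! ### Euclidean projection onto a convex set -/

namespace IsProjectionOracle

variable {d : ℕ} {X : Set (Vec d)} {Q : Vec d → Vec d}

theorem inner_le_zero (h : IsProjectionOracle X Q) (hX : Convex ℝ X) (u : Vec d) {w : Vec d}
    (hw : w ∈ X) : inner ℝ (u - Q u) (w - Q u) ≤ 0 := by
  obtain ⟨hu, hmin⟩ := h u
  have : Nonempty X := ⟨⟨w, hw⟩⟩
  refine (norm_eq_iInf_iff_real_inner_le_zero hX hu).1 (le_antisymm ?_ ?_) w hw
  · exact le_ciInf fun w => hmin w w.2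
  · exact ciInf_le (f := fun w : X => ‖u - w‖) ⟨0, by rintro _ ⟨w, rfl⟩; exact norm_nonneg _⟩ ⟨Q u, hu⟩

/-- Adding the obtuse angle inequalities at `Q u` and `Q v` gives `‖Q u - Q v‖ ^ 2 ≤ ⟪u - v, Q u - Q
v⟫`. -/
theorem norm_sub_le (h : IsProjectionOracle X Q) (hX : Convex ℝ X) (u v : Vec d) :
    ‖Q u - Q v‖ ≤ ‖u - v‖ := by
  have h₁ := h.inner_le_zero hX u (h v).1
  have h₂ := h.inner_le_zero hX v (h u).1
  have e : inner ℝ (u - v) (Q u - Q v) - ‖Q u - Q v‖ ^ 2 =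
      -inner ℝ (u - Q u) (Q v - Q u) - inner ℝ (v - Q v) (Q u - Q v) := by
    rw [← real_inner_self_eq_norm_sq, ← inner_neg_right, neg_sub, ← inner_sub_left,
      ← inner_sub_left]
    congr 1; abel
  have h₃ := real_inner_le_norm (u - v) (Q u - Q v)
  by_contra! hlt
  nlinarith [norm_nonneg (u - v)]

theorem eq_self (h : IsProjectionOracle X Q) {x : Vec d} (hx : x ∈ X) : Q x = x := by
  have := (h x).2 x hx
  rw [sub_self, norm_zero, norm_le_zero_iff, sub_eq_zero] at this
  exact this.symm

end IsProjectionOracle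

/-- Damping displaces `y` by at most `ε R`, which is added to the residual. -/
theorem norm_sub_le_of_residual {d : ℕ} {x y : Vec d} {ε R : ℝ} (hε : 0 < ε) (hy : ‖y‖ ≤ R)
    (h : ‖x - (1 - ε) • y‖ ≤ ε * R) : ‖x - y‖ ≤ 2 * ε * R := by
  have e : x - y = x - (1 - ε) • y - ε • y := by module
  rw [e]
  refine (norm_sub_le _ _).trans ?_
  rw [norm_smul, Real.norm_eq_abs, abs_of_pos hε]
  nlinarith

/-! ### The queries for the two access models -/

namespace PerfProblem

variable {d m : ℕ} {P : PerfProblem d m} {α β L ε r R : ℝ} {O : Oracles d}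

theorem norm_smul_rrm_sub_le (h : P.EuclideanAssumptions α β L) {G : Vec d → Vec d}
    (hρ : L * β / α ≤ 1 + ε) (hε1 : ε < 1) (hG : P.IsRRMMap G) {x y : Vec d} (hx : x ∈ P.X)
    (hy : y ∈ P.X) : ‖(1 - ε) • G x - (1 - ε) • G y‖ ≤ (1 - ε ^ 2) * ‖x - y‖ := by
  rw [← smul_sub, norm_smul, Real.norm_eq_abs, abs_of_pos (by linarith)]
  have h₁ := (norm_rrm_sub_le h hG hx hy).trans (mul_le_mul_of_nonneg_right hρ (norm_nonneg _))
  have h₂ := mul_le_mul_of_nonneg_left h₁ (by linarith : 0 ≤ 1 - ε)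
  linarith

/-- The centre `z` is the fixed point of `(1 - ε) G` in `X`. A separating hyperplane keeps all of
`X`, so the protected ball must lie in `X`; this is why its radius involves `r`. The program itself
never uses `r`. -/
theorem exists_isQuery_separationQuery (h : P.EuclideanAssumptions α β L)
    (hρ : L * β / α ≤ 1 + ε) (hε : 0 < ε) (hε1 : ε < 1) (hr : 0 < r) (hrR : r ≤ R)
    (hrX : Metric.closedBall 0 r ⊆ P.X) (hX : P.X ⊆ Metric.closedBall 0 R)
    (hS : IsSeparationOracle P.X O.domain) (hG : P.IsRRMMap O.rrm) :
    ∃ z, Metric.closedBall z (ε ^ 3 * r / 4) ⊆ Metric.closedBall 0 R ∧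
      Does.IsQuery O ε R (ε ^ 3 * r / 4) z (fun x => x ∈ P.X ∧ ‖x - O.rrm x‖ ≤ 2 * ε * R)
        Program.separationQuery := by
  have h0 : (0 : Vec d) ∈ P.X := hrX (by simpa using hr.le)
  have hR : 0 < R := hr.trans_le hrR
  have hT : Set.MapsTo (fun x => (1 - ε) • O.rrm x) P.X P.X := fun x hx =>
    P.convex_X.smul_mem_of_zero_mem h0 (hG x hx).1 ⟨by linarith, by linarith⟩
  obtain ⟨z, hz, hfix⟩ := exists_fixedPoint_of_norm_sub_le P.compact_X.isClosed P.nonempty_X hT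
    (q := 1 - ε ^ 2) (by nlinarith) fun x hx y hy => norm_smul_rrm_sub_le h hρ hε1 hG hx hy
  -- As `z = (1 - ε) G z`, convexity leaves room for `ε w` with any `w` in the ball of radius `r`;
  -- thus even the ball of radius `ε r` around `z` lies in `X`.
  have hball : Metric.closedBall z (ε ^ 3 * r / 4) ⊆ P.X := by
    intro y hy
    rw [mem_closedBall_iff_norm] at hy
    have hw : ε⁻¹ • (y - z) ∈ P.X := hrX <| by
      rw [mem_closedBall_zero_iff, norm_smul, norm_inv, Real.norm_eq_abs, abs_of_pos hε,
        inv_mul_le_iff₀ hε]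
      have : ε ^ 3 * r ≤ ε * r := by
        gcongr; exact pow_le_of_le_one hε.le hε1.le (by norm_num)
      nlinarith [mul_pos hε hr]
    have := P.convex_X (hG z hz).1 hw (by linarith : 0 ≤ 1 - ε) hε.le (by ring)
    rw [show (1 - ε) • O.rrm z = z from hfix, smul_smul, mul_inv_cancel₀ hε.ne', one_smul,
      add_sub_cancel] at this
    exact this
  refine ⟨z, hball.trans hX, fun s hs hf => ?_⟩
  refine ((Does.askDomain O 2 4 s).seq fun s₁ ⟨g₁, A₁⟩ => ?_).mono (C := d + 1 + (d * 8 + 4 +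
    (3 + (d * 4 + 2 + 30 * (d + 1))))) (by omega) fun _ h => h
  have r₁ := hs.of_agree A₁ (by decide) (by decide) (by decide)
  refine (Does.normSq (by decide) r₁.dim r₁.zero).seq fun s₂ ⟨A₂, n₂⟩ => ?_
  have r₂ := r₁.of_agree A₂ (by decide) (by decide) (by decide)
  have A : Agree {4, 9} {1, 2} s s₂ :=
    (A₁.mono (by decide) (by decide)).trans (A₂.mono (by decide) (by decide))
  have f₂ : s₂.idx 4 = 0 := by rw [A.idx 4 (by decide), hf]
  have c₂ : s₂.vec d 2 = s.vec d 2 := A.vec_eq (by decide) d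
  have g₂ : s₂.vec d 4 = O.domain (s.vec d 2) := by rw [A₂.vec_eq (by decide), g₁]
  refine Does.branch (fun hc => ?_) fun hc => ?_
  · have hx : s.vec d 2 ∈ P.X := by
      simp only [Test.holds, RExpr.eval, r₂.zero, n₂, g₁] at hc
      by_contra hx
      have := norm_pos_iff.2 ((hS _).2 hx).1
      rw [Rat.cast_zero] at hc
      exact (pow_pos this 2).not_ge hc
    refine (Does.vecAssign (fun i => s.mem 2 i 0) r₂.dim r₂.zero fun i _ s' hA _ h1 => ?_).seq
      fun s₃ ⟨A₃, v₃⟩ => ?_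
    · simp only [RExpr.eval, h1, hA.idx 3 (by decide), r₂.zero, hA.mem 2 (by decide),
        A.mem 2 (by decide)]
    have r₃ := r₂.of_agree A₃ (by decide) (by decide) (by decide)
    have p₃ : s₃.vec d 5 = s.vec d 2 := by ext i; exact v₃ i i.2
    have c₃ : s₃.vec d 2 = s.vec d 2 := by rw [A₃.vec_eq (by decide), c₂]
    refine (Does.residual r₃ (by rw [A₃.idx 4 (by decide), f₂]) hε.le hR.le).mono le_rfl
      fun s' ⟨A', g', h'⟩ => ⟨?_, ?_⟩
    · exact ((A.mono (by decide) (by decide)).trans (A₃.mono (by decide) (by decide))).trans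
        (A'.mono (by decide) le_rfl)
    · have p' : s'.vec d 5 = s.vec d 2 := by rw [A'.vec_eq (by decide), p₃]
      have c' : s'.vec d 2 = s.vec d 2 := by rw [A'.vec_eq (by decide), c₃]
      rw [p₃, c₃] at g'
      rw [g'] at h'
      rw [p', c', g']
      rcases h' with ⟨f', h'⟩ | ⟨f', h'⟩
      · exact .inl ⟨f', hx, norm_sub_le_of_residual hε
          (mem_closedBall_zero_iff.1 (hX (hG _ hx).1)) h'⟩
      · refine .inr ⟨f', norm_pos_iff.1 ((by positivity : 0 < ε * R).trans h'), ?_⟩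
        refine (Metric.closedBall_subset_closedBall (by gcongr)).trans
          (closedBall_subset_halfspace hε ?_ h')
        have := norm_smul_rrm_sub_le h hρ hε1 hG hx hz
        rwa [show (1 - ε) • O.rrm z = z from hfix] at this
  · refine (Does.skip (Q := fun s' => s' = s₂) rfl).mono (by omega) fun s' e => ?_
    subst e
    refine ⟨A.mono (by decide) (by decide), .inr ⟨f₂, ?_, fun y hy => ?_⟩⟩
    · rintro h0
      simp only [Test.holds, RExpr.eval, r₂.zero, n₂, ← A₂.vec_eq (by decide : 4 ∉ ({9} : Finset ℕ)),
        h0] at hc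
      simp at hc
    · rw [Set.mem_ofPred_eq, g₂, c₂, inner_sub_right, sub_nonpos]
      by_cases hx : s.vec d 2 ∈ P.X
      · rw [(hS _).1 hx]; simp
      · exact (((hS _).2 hx).2 y (hball hy)).le

/-- Now `X` may have empty interior and may miss the origin, so the ellipsoids live in the ambient
space. The fixed point `z` of `(1 - ε) G ∘ Q` need not belong to `X`, but damping puts it in the
ball of radius `(1 - ε) R`, with room for the protected ball inside radius `R`. -/
theorem exists_isQuery_projectionQuery (h : P.EuclideanAssumptions α β L)
    (hρ : L * β / α ≤ 1 + ε) (hε : 0 < ε) (hε1 : ε < 1) (hR : 0 < R)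
    (hX : P.X ⊆ Metric.closedBall 0 R)
    (hQ : IsProjectionOracle P.X O.domain) (hG : P.IsRRMMap O.rrm) :
    ∃ z, Metric.closedBall z (ε ^ 3 * R / 4) ⊆ Metric.closedBall 0 R ∧
      Does.IsQuery O ε R (ε ^ 3 * R / 4) z (fun x => x ∈ P.X ∧ ‖x - O.rrm x‖ ≤ 2 * ε * R)
        Program.projectionQuery := by
  have hlip : ∀ x y, ‖(1 - ε) • O.rrm (O.domain x) - (1 - ε) • O.rrm (O.domain y)‖ ≤
      (1 - ε ^ 2) * ‖x - y‖ := fun x y =>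
    (norm_smul_rrm_sub_le h hρ hε1 hG (hQ x).1 (hQ y).1).trans
      (mul_le_mul_of_nonneg_left (hQ.norm_sub_le P.convex_X x y) (by nlinarith))
  obtain ⟨z, -, hfix⟩ := exists_fixedPoint_of_norm_sub_le
    (T := fun x => (1 - ε) • O.rrm (O.domain x)) isClosed_univ Set.univ_nonempty
    (Set.mapsTo_univ _ _) (q := 1 - ε ^ 2) (by nlinarith) fun x _ y _ => hlip x y
  have hfix : (1 - ε) • O.rrm (O.domain z) = z := hfix
  have hGR : ∀ x, ‖O.rrm (O.domain x)‖ ≤ R := fun x =>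
    mem_closedBall_zero_iff.1 (hX (hG _ (hQ x).1).1)
  refine ⟨z, fun y hy => ?_, fun s hs hf => ?_⟩
  · rw [mem_closedBall_iff_norm] at hy
    rw [mem_closedBall_zero_iff]
    have h₁ : ‖z‖ ≤ (1 - ε) * R := by
      rw [← hfix, norm_smul, Real.norm_eq_abs, abs_of_pos (by linarith)]
      exact mul_le_mul_of_nonneg_left (hGR z) (by linarith)
    have h₂ : ‖y‖ ≤ ‖z‖ + ‖y - z‖ := norm_le_norm_add_norm_sub' _ _
    have h₃ : ε ^ 3 * R ≤ ε * R := by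
      gcongr; exact pow_le_of_le_one hε.le hε1.le (by norm_num)
    nlinarith [mul_pos hε hR]
  · refine ((Does.askDomain O 2 5 s).seq fun s₁ ⟨p₁, A₁⟩ => ?_).mono
      (C := d + 1 + 30 * (d + 1)) (by omega) fun _ h => h
    have r₁ := hs.of_agree A₁ (by decide) (by decide) (by decide)
    have c₁ : s₁.vec d 2 = s.vec d 2 := A₁.vec_eq (by decide) d
    refine (Does.residual r₁ (by rw [A₁.idx 4 (by decide), hf]) hε.le hR.le).mono le_rfl
      fun s' ⟨A', g', h'⟩ => ⟨?_, ?_⟩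
    · exact (A₁.mono (by decide) (by decide)).trans (A'.mono (by decide) le_rfl)
    · have p' : s'.vec d 5 = O.domain (s.vec d 2) := by rw [A'.vec_eq (by decide), p₁]
      have c' : s'.vec d 2 = s.vec d 2 := by rw [A'.vec_eq (by decide), c₁]
      rw [p₁, c₁] at g'
      rw [g'] at h'
      rw [p', c', g']
      rcases h' with ⟨f', h'⟩ | ⟨f', h'⟩
      · refine .inl ⟨f', (hQ _).1, ?_⟩
        have h₁ := norm_sub_le_of_residual hε (hGR _) h'
        -- The small gap is known at the centre `x`, not at `Q x`. Since `Q` is nonexpansive and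
        -- fixes `G (Q x) ∈ X`, projecting does not increase it.
        have h₂ := hQ.norm_sub_le P.convex_X (s.vec d 2) (O.rrm (O.domain (s.vec d 2)))
        rw [hQ.eq_self (hG _ (hQ _).1).1] at h₂
        exact h₂.trans h₁
      · refine .inr ⟨f', norm_pos_iff.1 ((by positivity : 0 < ε * R).trans h'),
          closedBall_subset_halfspace hε ?_ h'⟩
        have := hlip (s.vec d 2) z
        rwa [hfix] at this

end PerfProblem

/-- With `M` the base of the power on the right, `log 4 ≤ 3` bounds the logarithm by `3 M`. There
are then at most `3 M ^ 4` cuts, at a cost of at most `300 M ^ 2` each; the extra `2` is absorbed by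
`2 M ^ 4`. -/
theorem solver_steps_le (d : ℕ) {ε r R : ℝ} (hε : 0 < ε) (hε1 : ε < 1) (hr : 0 < r) (hrR : r ≤ R) :
    (((⌊((d + 1) ^ 2 * (d * Real.log (R / (ε ^ 3 * r / 4))) : ℝ)⌋₊ + 2) * (300 * (d + 1) ^ 2) : ℕ) :
      ℝ) ≤ (1500 : ℕ) * (1 + d + Real.log (1 / ε) + Real.log (R / r)) ^ 6 := by
  have hR : 0 < R := hr.trans_le hrR
  have hd : (0 : ℝ) ≤ d := Nat.cast_nonneg d
  have l₁ : 0 ≤ Real.log (1 / ε) := Real.log_nonneg (by rw [le_div_iff₀ hε]; linarith)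
  have l₂ : 0 ≤ Real.log (R / r) := Real.log_nonneg (by rwa [le_div_iff₀ hr, one_mul])
  have l₄ : Real.log 4 ≤ 3 := by
    have := Real.log_le_sub_one_of_pos (by norm_num : (0 : ℝ) < 4); linarith
  have e : Real.log (R / (ε ^ 3 * r / 4)) =
      Real.log (R / r) + 3 * Real.log (1 / ε) + Real.log 4 := by
    have : R / (ε ^ 3 * r / 4) = R / r * (1 / ε) ^ 3 * 4 := by field_simp
    rw [this, Real.log_mul (by positivity) (by norm_num),
      Real.log_mul (by positivity) (by positivity), Real.log_pow]
    norm_num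
  set M := 1 + d + Real.log (1 / ε) + Real.log (R / r) with hM
  have hM1 : 1 ≤ M := by linarith
  have hlog : Real.log (R / (ε ^ 3 * r / 4)) ≤ 3 * M := by rw [e, hM]; linarith
  have hlog0 : 0 ≤ Real.log (R / (ε ^ 3 * r / 4)) := by
    rw [e]; have := Real.log_nonneg (by norm_num : (1 : ℝ) ≤ 4); linarith
  have hdM : (d : ℝ) + 1 ≤ M := by linarith
  have hN : (⌊((d + 1) ^ 2 * (d * Real.log (R / (ε ^ 3 * r / 4))) : ℝ)⌋₊ : ℝ) ≤ 3 * M ^ 4 := by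
    refine (Nat.floor_le (by positivity)).trans ?_
    calc _ ≤ M ^ 2 * (M * (3 * M)) := by gcongr; linarith
      _ = 3 * M ^ 4 := by ring
  push_cast
  calc _ ≤ (3 * M ^ 4 + 2 * M ^ 4) * (300 * M ^ 2) := by
        gcongr
        linarith [one_le_pow₀ hM1 (n := 4)]
    _ = 1500 * M ^ 6 := by ring

end

theorem mainTheorem2 :
    -- well-bounded domains given by a separation oracle
    (∃ (prog : Program) (c : ℝ) (K k : ℕ),
      ∀ (d m : ℕ) (P : PerfProblem d m) (α β L ε r R : ℝ) (O : Oracles d),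
        P.EuclideanAssumptions α β L → L * β / α ≤ 1 + ε → 0 < ε → ε < 1 →
        0 < r → r ≤ R → Metric.closedBall 0 r ⊆ P.X → P.X ⊆ Metric.closedBall 0 R →
        IsSeparationOracle P.X O.domain → P.IsRRMMap O.rrm →
        ∃ (s : Store) (t : ℕ), Run O prog (Store.init d ε R) s t ∧
          (t : ℝ) ≤ K * (1 + d + Real.log (1 / ε) + Real.log (R / r)) ^ k ∧
          P.Guarantee O.rrm β L R ε c (s.vec d 0)) ∧
    -- arbitrary convex compact domains given by a projection oracle
    (∃ (prog : Program) (c : ℝ) (K k : ℕ),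
      ∀ (d m : ℕ) (P : PerfProblem d m) (α β L ε R : ℝ) (O : Oracles d),
        P.EuclideanAssumptions α β L → L * β / α ≤ 1 + ε → 0 < ε → ε < 1 →
        0 < R → P.X ⊆ Metric.closedBall 0 R →
        IsProjectionOracle P.X O.domain → P.IsRRMMap O.rrm →
        ∃ (s : Store) (t : ℕ), Run O prog (Store.init d ε R) s t ∧
          (t : ℝ) ≤ K * (1 + d + Real.log (1 / ε)) ^ k ∧
          P.Guarantee O.rrm β L R ε c (s.vec d 0)) := by
  constructor
  · refine ⟨Program.solver Program.separationQuery, 8, 1500, 6,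
      fun d m P α β L ε r R O h hρ hε hε1 hr hrR hrX hX hS hG => ?_⟩
    have hR : 0 < R := hr.trans_le hrR
    obtain ⟨z, hz, hq⟩ :=
      PerfProblem.exists_isQuery_separationQuery h hρ hε hε1 hr hrR hrX hX hS hG
    obtain ⟨s, t, hrun, ht, hx, hgap⟩ := Does.solver hq (by positivity) hR hz
    exact ⟨s, t, hrun, (Nat.cast_le.2 ht).trans (solver_steps_le d hε hε1 hr hrR),
      .of_norm_sub_le h hG hρ hε hε1 hR hX hx hgap⟩
  · refine ⟨Program.solver Program.projectionQuery, 8, 1500, 6,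
      fun d m P α β L ε R O h hρ hε hε1 hR hX hQ hG => ?_⟩
    obtain ⟨z, hz, hq⟩ := PerfProblem.exists_isQuery_projectionQuery h hρ hε hε1 hR hX hQ hG
    obtain ⟨s, t, hrun, ht, hx, hgap⟩ := Does.solver hq (by positivity) hR hz
    -- The protected radius is `ε ^ 3 * R / 4`, so the bound applies with `r = R` and `log (R / r)`
    -- vanishes.
    have hsteps := solver_steps_le d hε hε1 hR le_rfl
    rw [div_self hR.ne', Real.log_one, add_zero] at hsteps
    exact ⟨s, t, hrun, (Nat.cast_le.2 ht).trans hsteps,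
      .of_norm_sub_le h hG hρ hε hε1 hR hX hx hgap⟩
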